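/- Throughout, powers and $\operatorname{Arg}\in(-\pi,\pi]$ are principal. Let $0\le m\le q$, $0\le n\le p$ be integers, $a_1,\dots,a_p,b_1,\dots,b_q\in\mathbb C$, and let $r\in\mathbb R\setminus\{0\}$. The generalized Meijer $G$-function is $$G^{m,n}_{p,q}\!\left(x,r\,\middle|\,{a_1,\dots,a_p\atop b_1,\dots,b_q}\right)=\frac1{2\pi i}\int_{\gamma-i\infty}^{\gamma+i\infty}\frac{\prod_{k=1}^m\Gamma(b_k+s)\prod_{k=1}^n\Gamma(1-a_k-s)}{\prod_{k=n+1}^p\Gamma(a_k+s)\prod_{k=m+1}^q\Gamma(1-b_k-s)}\,x^{-s/r}\,ds ,$$ the integral being taken along any vertical line on which it converges absolutely and which has the poles of $\Gamma(b_k+s)$ $(k\le m)$ on its left and those of $\Gamma(1-a_k-s)$ $(k\le n)$ on its right; $G^{m,n}_{p,q}(x|\cdot)$ is the case $r=1$. The Fox function $H^{m,n}_{p,q}\bigl[x\,\big|\,{(a_k,A_k)\atop(b_k,B_k)}\bigr]$, $A_k,B_k>0$, is defined in the same way, with $\Gamma(b_k+B_ks)$, $\Gamma(1-a_k-A_ks)$,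 $\Gamma(a_k+A_ks)$, $\Gamma(1-b_k-B_ks)$ and $x^{-s}$ in place of $\Gamma(b_k+s)$, $\Gamma(1-a_k-s)$, $\Gamma(a_k+s)$, $\Gamma(1-b_k-s)$ and $x^{-s/r}$. Put $$c=m+n-\tfrac{p+q}2,\qquad \mu=\sum_{k=1}^q b_k-\sum_{k=1}^p a_k+\tfrac{p-q}2+1 .$$ Let $\alpha,\beta,w,z\in\mathbb C$ with $w\ne0$, $z\neq 0$, $\operatorname{Re}\beta>0$, and let $g\in\mathbb R$ with $g/r>0$. Suppose that there is a real $\gamma$ with $-\operatorname{Re}b_k<\gamma$ for $1\le k\le m$, $\gamma<1-\operatorname{Re}a_k$ for $1\le k\le n$ and $\frac gr\gamma<\operatorname{Re}\alpha$, such that either * $c>0$ and $|\operatorname{Arg}(wz^g)|<|r|\,c\,\pi$, or * $c=0$, $wz^g>0$ and $(q-p)\gamma+\operatorname{Re}\mu<0$. Then $G^{m,n}_{p,q}(w\tau^g,r|a;b)$ is defined for all $\tau\neq0$ on the segment $[0,z]$, and the Riemann–Liouville integral $$I=\frac1{\Gamma(\beta)}\int_0^z(z-\tau)^{\beta-1}\tau^{\alpha-1}\,G^{m,n}_{p,q}\!\left(w\tau^g,r\,\middle|\,{a_1,\dots,a_p\atop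 b_1,\dots,b_q}\right)d\tau$$ along this segment converges absolutely. Moreover: 1. If $\operatorname{Arg}(wz^g)=r\operatorname{Arg}\bigl(w^{1/r}z^{g/r}\bigr)$ (which holds, for example, if $z>0$ and $-\pi<\operatorname{Arg}(w)/r\le\pi$), then the following $H$-function is defined and $$I=z^{\alpha+\beta-1}\,H^{m,n+1}_{p+1,q+1}\!\left[w^{1/r}z^{g/r}\,\middle|\,{(1-\alpha,\frac gr),(a_1,1),\dots,(a_p,1)\atop(b_1,1),\dots,(b_q,1),(1-\alpha-\beta,\frac gr)}\right].$$ 2. If $g$ and $r$ are positive integers, then the following $G$-function is defined and $$I=z^{\alpha+\beta-1}\,\frac{r^{\mu}}{(2\pi)^{(r-1)c}\,g^{\beta}}\;G^{rm,\,rn+g}_{rp+g,\,rq+g}\!\left(\frac{wz^g}{r^{r(q-p)}}\,\middle|\,{\Delta_1,\Delta_2\atop\Delta_3,\Delta_4}\right),$$ where, with $D_k(x)=\frac xk,\frac{x+1}k,\dots,\frac{x+k-1}k$, $$\Delta_1=D_g(1-\alpha),D_r(a_1),\dots,D_r(a_n),\qquad \Delta_2=D_r(a_{n+1}),\dots,D_r(a_p),$$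 $$\Delta_3=D_r(b_1),\dots,D_r(b_m),\qquad \Delta_4=D_r(b_{m+1}),\dots,D_r(b_q),D_g(1-\alpha-\beta).$$ -/

import Mathlib

open Complex MeasureTheory

noncomputable section

/-- `(1 / (2πi)) ∫ F(s) ds` over the upward vertical line `Re s = γ`. -/
def lineIntegral (F : ℂ → ℂ) (γ : ℝ) : ℂ :=
  1 / (2 * (Real.pi : ℂ) * I) * ∫ y : ℝ, F ((γ : ℂ) + (y : ℂ) * I) * I

/-- The gamma quotient of the Meijer G-function `G^{m,n}_{p,q}`. The parameters are given in four
lists, `a₁ = a_1,…,a_n`, `a₂ = a_{n+1},…,a_p`, `b₁ = b_1,…,b_m`, `b₂ = b_{m+1},…,b_q`, so that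
`m, n, p, q` are read off from their lengths. -/
def meijerKernel (a₁ a₂ b₁ b₂ : List ℂ) (s : ℂ) : ℂ :=
  ((b₁.map fun b => Gamma (b + s)).prod * (a₁.map fun a => Gamma (1 - a - s)).prod) /
    ((a₂.map fun a => Gamma (a + s)).prod * (b₂.map fun b => Gamma (1 - b - s)).prod)

/-- The Mellin–Barnes integrand of `G^{m,n}_{p,q}(z, r | a; b)`, with the principal power. -/
def meijerIntegrand (a₁ a₂ b₁ b₂ : List ℂ) (z : ℂ) (r : ℝ) (s : ℂ) : ℂ :=
  meijerKernel a₁ a₂ b₁ b₂ s * z ^ (-s / (r : ℂ))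

/-- The line `Re s = γ` is a contour for `G^{m,n}_{p,q}(z, r | a; b)`: the poles of the
`Γ(b_k + s)`, `k ≤ m`, are to its left, those of the `Γ(1 - a_k - s)`, `k ≤ n`, are to its right,
and the Mellin–Barnes integral converges absolutely along it. -/
structure IsMeijerContour (a₁ a₂ b₁ b₂ : List ℂ) (z : ℂ) (r γ : ℝ) : Prop where
  left : ∀ b ∈ b₁, 0 < b.re + γ
  right : ∀ a ∈ a₁, 0 < 1 - a.re - γ
  integrable : VerticalIntegrable (meijerIntegrand a₁ a₂ b₁ b₂ z r) γ

open Classical in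
/-- The generalized Meijer G-function `G^{m,n}_{p,q}(z, r | a; b)`: the Mellin–Barnes integral along
a vertical contour (with value `0` if there is none). -/
def meijerGr (a₁ a₂ b₁ b₂ : List ℂ) (z : ℂ) (r : ℝ) : ℂ :=
  if h : ∃ γ : ℝ, IsMeijerContour a₁ a₂ b₁ b₂ z r γ then
    lineIntegral (meijerIntegrand a₁ a₂ b₁ b₂ z r) h.choose
  else 0

/-- The classical Meijer G-function `G^{m,n}_{p,q}(z | a; b)`. -/
def meijerG (a₁ a₂ b₁ b₂ : List ℂ) (z : ℂ) : ℂ :=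
  meijerGr a₁ a₂ b₁ b₂ z 1

/-- The gamma quotient of the Fox H-function `H^{m,n}_{p,q}`; the parameters are the pairs
`(a_k, A_k)` and `(b_k, B_k)`, split into four lists as for the Meijer G-function. -/
def foxKernel (a₁ a₂ b₁ b₂ : List (ℂ × ℝ)) (s : ℂ) : ℂ :=
  ((b₁.map fun b => Gamma (b.1 + b.2 * s)).prod * (a₁.map fun a => Gamma (1 - a.1 - a.2 * s)).prod) /
    ((a₂.map fun a => Gamma (a.1 + a.2 * s)).prod * (b₂.map fun b => Gamma (1 - b.1 - b.2 * s)).prod)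

/-- The Mellin–Barnes integrand of the Fox H-function. -/
def foxIntegrand (a₁ a₂ b₁ b₂ : List (ℂ × ℝ)) (z : ℂ) (s : ℂ) : ℂ :=
  foxKernel a₁ a₂ b₁ b₂ s * z ^ (-s)

/-- The line `Re s = γ` is a contour for the Fox H-function: the coefficients `A_k`, `B_k` are
positive, the line separates the poles of the two products in the numerator, and the Mellin–Barnes
integral converges absolutely along it. -/
structure IsFoxContour (a₁ a₂ b₁ b₂ : List (ℂ × ℝ)) (z : ℂ) (γ : ℝ) : Prop where
  pos : ∀ c ∈ a₁ ++ a₂ ++ b₁ ++ b₂, 0 < c.2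
  left : ∀ b ∈ b₁, 0 < b.1.re + b.2 * γ
  right : ∀ a ∈ a₁, 0 < 1 - a.1.re - a.2 * γ
  integrable : VerticalIntegrable (foxIntegrand a₁ a₂ b₁ b₂ z) γ

open Classical in
/-- The Fox H-function `H^{m,n}_{p,q}[z | (a, A); (b, B)]`: the Mellin–Barnes integral along a
vertical contour (with value `0` if there is none). -/
def foxH (a₁ a₂ b₁ b₂ : List (ℂ × ℝ)) (z : ℂ) : ℂ :=
  if h : ∃ γ : ℝ, IsFoxContour a₁ a₂ b₁ b₂ z γ then
    lineIntegral (foxIntegrand a₁ a₂ b₁ b₂ z) h.choose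
  else 0

/-- `m + n - (p + q) / 2`. -/
def meijerC (a₁ a₂ b₁ b₂ : List ℂ) : ℝ :=
  ((b₁.length : ℝ) + a₁.length) - (((a₁ ++ a₂).length : ℝ) + (b₁ ++ b₂).length) / 2

/-- `μ = ∑ b_k - ∑ a_k + (p - q) / 2 + 1`. -/
def meijerMu (a₁ a₂ b₁ b₂ : List ℂ) : ℂ :=
  (b₁ ++ b₂).sum - (a₁ ++ a₂).sum + (((a₁ ++ a₂).length : ℂ) - (b₁ ++ b₂).length) / 2 + 1

/-- The explicit conditions of convergence of the Mellin–Barnes integral of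
`G^{m,n}_{p,q}(z, r | a; b)` along `Re s = γ`: either `m + n - (p + q) / 2 > 0` and
`|arg z| < |r| (m + n - (p + q) / 2) π`, or `m + n = (p + q) / 2`, `z` is positive and
`(q - p) γ + Re μ < 0`. -/
def MeijerConvergence (a₁ a₂ b₁ b₂ : List ℂ) (z : ℂ) (r γ : ℝ) : Prop :=
  (0 < meijerC a₁ a₂ b₁ b₂ ∧ |z.arg| < |r| * meijerC a₁ a₂ b₁ b₂ * Real.pi) ∨
    (meijerC a₁ a₂ b₁ b₂ = 0 ∧ z.arg = 0 ∧
      (((b₁ ++ b₂).length : ℝ) - (a₁ ++ a₂).length) * γ + (meijerMu a₁ a₂ b₁ b₂).re < 0)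

/-- The integrand of the Riemann–Liouville integral of order `β` of `f` from `0` to the complex
point `z`, with the segment parametrized as `τ = t z`, `0 ≤ t ≤ 1`, `dτ = z dt`. -/
def rlIntegrand (β : ℂ) (f : ℂ → ℂ) (z : ℂ) (t : ℝ) : ℂ :=
  (z - t * z) ^ (β - 1) * f (t * z) * z

/-- The Riemann–Liouville integral `(1 / Γ(β)) ∫_0^z (z - τ)^(β - 1) f(τ) dτ`. -/
def rlIntegral (β : ℂ) (f : ℂ → ℂ) (z : ℂ) : ℂ :=
  1 / Gamma β * ∫ t in (0 : ℝ)..1, rlIntegrand β f z t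

/-- The list `c / k, (c + 1) / k, …, (c + k - 1) / k`. -/
def gaussList (k : ℕ) (c : ℂ) : List ℂ :=
  (List.range k).map fun j => (c + j) / k

/-- The pairs `(c, 1)` for `c` in the list. -/
def withOne (l : List ℂ) : List (ℂ × ℝ) :=
  l.map fun c => (c, 1)

end

/-!
By Stirling's formula the Mellin–Barnes kernel of the `G`-function is of exact order
`(1 + |y|) ^ e * exp (-cπ |y|)`, with `e = (q - p) γ + Re μ - 1`, on the line `Re s = γ`, while
`x ^ (-s / r)` is at most of order `exp (|arg x| |y| / |r|)`; this is where the two convergence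
conditions come from. The upper bound for `Γ` is a Phragmén–Lindelöf estimate of
`Γ(s) s ^ (1 / 2 - s)` on `1 / 2 ≤ Re s ≤ 3 / 2`, propagated by `Γ(s + 1) = s Γ(s)`, and the lower
bound follows from it by the reflection formula. Multiplying by `exp (ε s ^ 2)` makes Cauchy's
theorem applicable between any two admissible lines, so the contour integral does not depend on
the line.

After `τ = t z` and Fubini's theorem, the Beta integral in `t` multiplies the integrand by
`Γ(α - g s / r) / Γ(α + β - g s / r)`, giving the kernel of the `H`-function. For integers `g`
and `r` the substitution `s ↦ r s` makes all arguments integer multiples of `s`, and Gauss's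
multiplication formula splits every gamma factor into those of a `G`-function.
-/

section GaussMultiplication

open Finset

lemma sin_pi_mul_succ_div_pos {n k : ℕ} (hk : k < n) :
    0 < Real.sin (Real.pi * ((k + 1) / (n + 1))) := by
  have hk' : (k : ℝ) + 1 ≤ n := by exact_mod_cast hk
  have hlt : ((k : ℝ) + 1) / (n + 1) < 1 := by rw [div_lt_one (by positivity)]; linarith
  exact Real.sin_pos_of_pos_of_lt_pi (by positivity) (by nlinarith [Real.pi_pos])

lemma prod_two_mul_sin_pi_div (n : ℕ) :
    ∏ k ∈ range n, (2 * Real.sin (Real.pi * ((k + 1) / (n + 1)))) = n + 1 := by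
  have hroot := Complex.isPrimitiveRoot_exp (n + 1) n.succ_ne_zero
  have hnorm := congrArg norm hroot.prod_one_sub_pow_eq_order
  have hn : ‖(n : ℂ) + 1‖ = n + 1 := by exact_mod_cast norm_natCast (n + 1)
  rw [norm_prod, hn] at hnorm
  refine (prod_congr rfl fun k hk => ?_).trans hnorm
  have hexp : ((k + 1 : ℕ) : ℂ) * (2 * Real.pi * I / ((n + 1 : ℕ) : ℂ)) =
      I * ((2 * (Real.pi * ((k + 1) / (n + 1))) : ℝ) : ℂ) := by
    push_cast
    ring
  rw [norm_sub_rev, ← Complex.exp_nat_mul, hexp, Complex.norm_exp_I_mul_ofReal_sub_one,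
    mul_div_cancel_left₀ _ (two_ne_zero' ℝ), Real.norm_of_nonneg]
  exact mul_nonneg zero_le_two (sin_pi_mul_succ_div_pos (mem_range.mp hk)).le

lemma prod_Gamma_succ_div_sq (n : ℕ) :
    (∏ k ∈ range n, Real.Gamma ((k + 1) / (n + 1))) ^ 2 = (2 * Real.pi) ^ n / (n + 1) := by
  have hreflect : ∏ k ∈ range n, Real.Gamma (((k : ℝ) + 1) / (n + 1)) =
      ∏ k ∈ range n, Real.Gamma (1 - ((k : ℝ) + 1) / (n + 1)) := by
    rw [← prod_range_reflect]
    refine prod_congr rfl fun k hk => congrArg Real.Gamma ?_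
    have hk' := mem_range.mp hk
    rw [Nat.sub_sub, Nat.cast_sub (by omega)]
    push_cast
    field_simp
    ring
  calc (∏ k ∈ range n, Real.Gamma ((k + 1) / (n + 1))) ^ 2
      = ∏ k ∈ range n,
          Real.Gamma (((k : ℝ) + 1) / (n + 1)) * Real.Gamma (1 - ((k : ℝ) + 1) / (n + 1)) := by
        rw [sq, prod_mul_distrib, ← hreflect]
    _ = ∏ k ∈ range n, 2 * Real.pi / (2 * Real.sin (Real.pi * ((k + 1) / (n + 1)))) :=
        prod_congr rfl fun k _ => by
          rw [Real.Gamma_mul_Gamma_one_sub, mul_div_mul_left _ _ two_ne_zero]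
    _ = (2 * Real.pi) ^ n / (n + 1) := by
        rw [prod_div_distrib, prod_const, card_range, prod_two_mul_sin_pi_div]

lemma prod_Gamma_succ_div (n : ℕ) :
    ∏ k ∈ range n, Real.Gamma ((k + 1) / (n + 1)) =
      (2 * Real.pi) ^ ((n : ℝ) / 2) * (n + 1 : ℝ) ^ (-1 / 2 : ℝ) := by
  have hpos : 0 ≤ ∏ k ∈ range n, Real.Gamma (((k : ℝ) + 1) / (n + 1)) :=
    prod_nonneg fun k _ => (Real.Gamma_pos_of_pos (by positivity)).le
  refine (sq_eq_sq₀ hpos (by positivity)).mp ?_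
  have hpi : ((2 * Real.pi) ^ ((n : ℝ) / 2)) ^ 2 = (2 * Real.pi) ^ n := by
    rw [← Real.rpow_mul_natCast (by positivity), Nat.cast_ofNat, div_mul_cancel₀ _ two_ne_zero,
      Real.rpow_natCast]
  have hn : ((n + 1 : ℝ) ^ (-1 / 2 : ℝ)) ^ 2 = (n + 1 : ℝ)⁻¹ := by
    rw [← Real.rpow_mul_natCast (by positivity), Nat.cast_ofNat, div_mul_cancel₀ _ two_ne_zero,
      Real.rpow_neg_one]
  rw [prod_Gamma_succ_div_sq, mul_pow ((2 * Real.pi) ^ ((n : ℝ) / 2)), hpi, hn, div_eq_mul_inv]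

lemma convexOn_log_Gamma_add_div {c d : ℝ} (hc : 0 < c) (hd : 0 ≤ d) :
    ConvexOn ℝ (Set.Ioi 0) fun s : ℝ => Real.log (Real.Gamma ((s + d) / c)) := by
  refine ⟨convex_Ioi 0, fun x hx y hy a b ha hb hab => ?_⟩
  have hx' : 0 < (x + d) / c := div_pos (add_pos_of_pos_of_nonneg hx hd) hc
  have hy' : 0 < (y + d) / c := div_pos (add_pos_of_pos_of_nonneg hy hd) hc
  have haffine : (a • x + b • y + d) / c = a • ((x + d) / c) + b • ((y + d) / c) := by
    simp only [smul_eq_mul]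
    field_simp
    linear_combination -d * hab
  simpa only [haffine] using! Real.convexOn_log_Gamma.2 hx' hy' ha hb hab

/-- The expression in `s` which Gauss's multiplication formula with `n + 1` factors equates with
`Γ(s)`, on the model of `Real.doublingGamma`. -/
noncomputable def multiplicationGamma (n : ℕ) (s : ℝ) : ℝ :=
  (∏ k ∈ range (n + 1), Real.Gamma ((s + k) / (n + 1))) * (n + 1 : ℝ) ^ (s - 1 / 2) /
    (2 * Real.pi) ^ ((n : ℝ) / 2)

namespace multiplicationGamma

lemma prod_Gamma_pos (n : ℕ) {s : ℝ} (hs : 0 < s) :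
    0 < ∏ k ∈ range (n + 1), Real.Gamma ((s + k) / (n + 1)) :=
  prod_pos fun _ _ => Real.Gamma_pos_of_pos (by positivity)

lemma pos (n : ℕ) {s : ℝ} (hs : 0 < s) : 0 < multiplicationGamma n s :=
  div_pos (mul_pos (prod_Gamma_pos n hs) (by positivity)) (by positivity)

lemma add_one (n : ℕ) {s : ℝ} (hs : 0 < s) :
    multiplicationGamma n (s + 1) = s * multiplicationGamma n s := by
  have hlast : (s + 1 + n) / (n + 1) = (s + (0 : ℕ)) / (n + 1) + 1 := by
    push_cast
    field_simp
    ring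
  have hshift (k : ℕ) : s + 1 + (k : ℝ) = s + ((k + 1 : ℕ) : ℝ) := by push_cast; ring
  have hprod : ∏ k ∈ range (n + 1), Real.Gamma ((s + 1 + k) / (n + 1)) =
      s / (n + 1) * ∏ k ∈ range (n + 1), Real.Gamma ((s + k) / (n + 1)) := by
    rw [prod_range_succ, prod_range_succ' (fun k : ℕ => Real.Gamma ((s + k) / (n + 1))), hlast,
      Real.Gamma_add_one (by push_cast; positivity)]
    simp_rw [hshift]
    push_cast
    ring
  rw [multiplicationGamma, multiplicationGamma, hprod, show s + 1 - 1 / 2 = s - 1 / 2 + 1 by ring,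
    Real.rpow_add_one (by positivity)]
  field_simp

lemma one (n : ℕ) : multiplicationGamma n 1 = 1 := by
  have hn : (0 : ℝ) < n + 1 := by positivity
  have hc : (2 * Real.pi) ^ ((n : ℝ) / 2) ≠ 0 := by positivity
  have hcomm (k : ℕ) : (1 : ℝ) + k = k + 1 := add_comm _ _
  simp_rw [multiplicationGamma, prod_range_succ, hcomm, div_self hn.ne', Real.Gamma_one, mul_one,
    prod_Gamma_succ_div, mul_assoc, ← Real.rpow_add hn]
  norm_num [hc]

lemma convexOn_log (n : ℕ) : ConvexOn ℝ (Set.Ioi 0) (Real.log ∘ multiplicationGamma n) := by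
  have hsum : ConvexOn ℝ (Set.Ioi (0 : ℝ)) fun s : ℝ =>
      ∑ k ∈ range (n + 1), Real.log (Real.Gamma ((s + k) / (n + 1))) := by
    induction range (n + 1) using Finset.cons_induction with
    | empty => simpa only [sum_empty] using convexOn_const (0 : ℝ) (convex_Ioi (0 : ℝ))
    | cons k t hk ih =>
      simp_rw [sum_cons]
      exact (convexOn_log_Gamma_add_div (by positivity) (Nat.cast_nonneg k)).add ih
  have haffine : ConvexOn ℝ (Set.Ioi (0 : ℝ)) fun s : ℝ =>
      (s - 1 / 2) * Real.log (n + 1) - Real.log ((2 * Real.pi) ^ ((n : ℝ) / 2)) := by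
    refine ⟨convex_Ioi 0, fun x _ y _ a b _ _ hab => le_of_eq ?_⟩
    obtain rfl : b = 1 - a := by linarith
    simp only [smul_eq_mul]
    ring
  refine (hsum.add haffine).congr fun s hs => ?_
  have hs' : (0 : ℝ) < s := hs
  rw [Pi.add_apply, Function.comp_apply, multiplicationGamma,
    Real.log_div (mul_pos (prod_Gamma_pos n hs) (by positivity)).ne' (by positivity),
    Real.log_mul (prod_Gamma_pos n hs).ne' (by positivity),
    Real.log_rpow (x := (n : ℝ) + 1) (by positivity),
    Real.log_prod fun k _ => (Real.Gamma_pos_of_pos (by positivity)).ne', add_sub_assoc]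

lemma eq_Gamma (n : ℕ) {s : ℝ} (hs : 0 < s) : multiplicationGamma n s = Real.Gamma s :=
  Real.eq_Gamma_of_log_convex (convexOn_log n) (add_one n) (pos n) (one n) hs

end multiplicationGamma

lemma prod_real_Gamma_add_div (n : ℕ) {s : ℝ} (hs : 0 < s) :
    ∏ k ∈ range (n + 1), Real.Gamma ((s + k) / (n + 1)) =
      (2 * Real.pi) ^ ((n : ℝ) / 2) * (n + 1 : ℝ) ^ (1 / 2 - s) * Real.Gamma s := by
  have hcancel : (n + 1 : ℝ) ^ (1 / 2 - s) * (n + 1 : ℝ) ^ (s - 1 / 2) = 1 := by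
    rw [← Real.rpow_add (by positivity), sub_add_sub_cancel', sub_self, Real.rpow_zero]
  rw [← multiplicationGamma.eq_Gamma n hs, multiplicationGamma, mul_div_assoc',
    eq_div_iff (by positivity)]
  linear_combination -(2 * Real.pi) ^ ((n : ℝ) / 2) *
    (∏ k ∈ range (n + 1), Real.Gamma ((s + k) / (n + 1))) * hcancel

lemma prod_Gamma_add_div_inv (n : ℕ) (s : ℂ) :
    ∏ k ∈ range (n + 1), (Gamma ((s + k) / (n + 1)))⁻¹ =
      (2 * (Real.pi : ℂ)) ^ (-(n : ℂ) / 2) * (n + 1 : ℂ) ^ (s - 1 / 2) * (Gamma s)⁻¹ := by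
  have hn : (n + 1 : ℂ) ≠ 0 := Nat.cast_add_one_ne_zero n
  have hleft : Differentiable ℂ
      fun z : ℂ => ∏ k ∈ range (n + 1), (Gamma ((z + k) / (n + 1)))⁻¹ :=
    Differentiable.fun_finsetProd fun k _ => differentiable_one_div_Gamma.comp
      ((differentiable_id.add_const _).div_const _)
  have hright : Differentiable ℂ fun z : ℂ =>
      (2 * (Real.pi : ℂ)) ^ (-(n : ℂ) / 2) * (n + 1 : ℂ) ^ (z - 1 / 2) * (Gamma z)⁻¹ :=
    ((differentiable_const _).mul ((differentiable_id.sub_const _).const_cpow (Or.inl hn))).mul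
      differentiable_one_div_Gamma
  refine congrFun (AnalyticOnNhd.eq_of_frequently_eq (z₀ := 1)
    (hleft.differentiableOn.analyticOnNhd isOpen_univ)
    (hright.differentiableOn.analyticOnNhd isOpen_univ) ?_) s
  have hofReal : Filter.Tendsto ((↑) : ℝ → ℂ) (nhdsWithin 1 {1}ᶜ) (nhdsWithin 1 {1}ᶜ) :=
    tendsto_nhdsWithin_iff.mpr ⟨tendsto_nhdsWithin_of_tendsto_nhds continuous_ofReal.continuousAt,
      eventually_nhdsWithin_iff.mpr (.of_forall fun t ht => ofReal_ne_one.mpr ht)⟩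
  refine hofReal.frequently (Filter.Eventually.frequently ?_)
  filter_upwards [nhdsWithin_le_nhds (lt_mem_nhds zero_lt_one)] with t ht
  have h := congrArg (fun x : ℝ => ((x⁻¹ : ℝ) : ℂ)) (prod_real_Gamma_add_div n ht)
  simp only [mul_inv, ← prod_inv_distrib] at h
  rw [← Real.rpow_neg (by positivity), ← Real.rpow_neg (by positivity)] at h
  push_cast [ofReal_cpow (show (0 : ℝ) ≤ 2 * Real.pi by positivity),
    ofReal_cpow (show (0 : ℝ) ≤ n + 1 by positivity), ← Gamma_ofReal] at h
  rw [h, neg_div, neg_sub]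

theorem prod_Gamma_add_div {n : ℕ} (hn : n ≠ 0) (s : ℂ) :
    ∏ k ∈ range n, Gamma ((s + k) / n) =
      (2 * (Real.pi : ℂ)) ^ (((n : ℂ) - 1) / 2) * (n : ℂ) ^ (1 / 2 - s) * Gamma s := by
  obtain ⟨n, rfl⟩ := Nat.exists_eq_succ_of_ne_zero hn
  have h := congrArg Inv.inv (prod_Gamma_add_div_inv n s)
  simp only [prod_inv_distrib, inv_inv, mul_inv, ← cpow_neg, neg_div, neg_neg, neg_sub] at h
  push_cast
  rw [h, add_sub_cancel_right]

end GaussMultiplication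

section VerticalStrips

open Filter Topology

/-- `f` grows at most exponentially in `|Im s|`, uniformly on the vertical strip `Re s ∈ S`. -/
def ExpGrowthOnStrip {E : Type*} [Norm E] (S : Set ℝ) (f : ℂ → E) : Prop :=
  ∃ C D : ℝ, ∀ s : ℂ, s.re ∈ S → ‖f s‖ ≤ C * Real.exp (D * |s.im|)

namespace ExpGrowthOnStrip

lemma of_norm_le {E : Type*} [Norm E] {S : Set ℝ} {f : ℂ → E} {C : ℝ}
    (h : ∀ s : ℂ, s.re ∈ S → ‖f s‖ ≤ C) : ExpGrowthOnStrip S f :=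
  ⟨C, 0, by simpa using h⟩

lemma comp_affine {E : Type*} [Norm E] {S : Set ℝ} {f : ℂ → E} (u : ℂ) (c : ℝ)
    (h : ExpGrowthOnStrip ((fun x => u.re + c * x) '' S) f) :
    ExpGrowthOnStrip S fun s => f (u + c * s) := by
  obtain ⟨C, D, hf⟩ := h
  refine ⟨|C| * Real.exp (|D| * |u.im|), |D| * |c|, fun s hs => ?_⟩
  calc ‖f (u + c * s)‖ ≤ C * Real.exp (D * |(u + c * s).im|) := hf _ ⟨s.re, hs, by simp⟩
    _ ≤ |C| * Real.exp (|D| * (|u.im| + |c| * |s.im|)) := by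
        have him : |(u + c * s).im| ≤ |u.im| + |c| * |s.im| := by
          rw [add_im, im_ofReal_mul, ← abs_mul]
          exact abs_add_le _ _
        gcongr
        · exact le_abs_self C
        · exact le_abs_self D
    _ = _ := by rw [mul_add, Real.exp_add, mul_assoc, mul_assoc]

lemma mul {A : Type*} [SeminormedRing A] {S : Set ℝ} {f g : ℂ → A} (hf : ExpGrowthOnStrip S f)
    (hg : ExpGrowthOnStrip S g) : ExpGrowthOnStrip S fun s => f s * g s := by
  obtain ⟨C, D, hf⟩ := hf
  obtain ⟨C', D', hg⟩ := hg
  refine ⟨C * C', D + D', fun s hs => (norm_mul_le _ _).trans ?_⟩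
  calc ‖f s‖ * ‖g s‖
      ≤ C * Real.exp (D * |s.im|) * (C' * Real.exp (D' * |s.im|)) :=
        mul_le_mul (hf s hs) (hg s hs) (norm_nonneg _) ((norm_nonneg _).trans (hf s hs))
    _ = C * C' * Real.exp ((D + D') * |s.im|) := by rw [mul_mul_mul_comm, ← Real.exp_add, add_mul]

lemma list_prod {A ι : Type*} [SeminormedRing A] {S : Set ℝ} {l : List ι} {f : ι → ℂ → A}
    (hf : ∀ i ∈ l, ExpGrowthOnStrip S (f i)) :
    ExpGrowthOnStrip S fun s => (l.map fun i => f i s).prod := by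
  induction l with
  | nil => exact of_norm_le (C := ‖(1 : A)‖) fun s _ => by rw [List.map_nil, List.prod_nil]
  | cons i l ih =>
    rw [List.forall_mem_cons] at hf
    simpa only [List.map_cons, List.prod_cons] using hf.1.mul (ih hf.2)

variable {E : Type*} [NormedAddCommGroup E] [NormedSpace ℂ E]

theorem norm_le_of_boundary {a b B : ℝ} {f : ℂ → E} (hf : ExpGrowthOnStrip (Set.Ioo a b) f)
    (hd : DiffContOnCl ℂ f (re ⁻¹' Set.Ioo a b)) (ha : ∀ s : ℂ, s.re = a → ‖f s‖ ≤ B)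
    (hb : ∀ s : ℂ, s.re = b → ‖f s‖ ≤ B) {s : ℂ} (has : a ≤ s.re) (hsb : s.re ≤ b) :
    ‖f s‖ ≤ B := by
  rcases (has.trans hsb).eq_or_lt with rfl | hab
  · exact ha s (hsb.antisymm has)
  obtain ⟨C, D, hf⟩ := hf
  have hc : 0 < Real.pi / (b - a) / 2 := half_pos (div_pos Real.pi_pos (sub_pos.mpr hab))
  refine PhragmenLindelof.vertical_strip hd
    ⟨Real.pi / (b - a) / 2, half_lt_self (div_pos Real.pi_pos (sub_pos.mpr hab)),
      |D| / (Real.pi / (b - a) / 2), .of_bound |C| (mem_inf_of_right fun s hs => ?_)⟩ ha hb has hsb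
  rw [Set.mem_ofPred_eq, Real.norm_of_nonneg (Real.exp_pos _).le]
  refine (hf s hs).trans (mul_le_mul (le_abs_self C) (Real.exp_le_exp.mpr ?_)
    (Real.exp_pos _).le (abs_nonneg C))
  calc D * |s.im| ≤ |D| * |s.im| := by gcongr; exact le_abs_self D
    _ = |D| / (Real.pi / (b - a) / 2) * (Real.pi / (b - a) / 2 * |s.im|) := by
        rw [← mul_assoc, div_mul_cancel₀ _ hc.ne']
    _ ≤ _ := by
        gcongr
        linarith [Real.add_one_le_exp (Real.pi / (b - a) / 2 * |s.im|)]

end ExpGrowthOnStrip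

variable {E : Type*} [NormedAddCommGroup E] [NormedSpace ℂ E] {F : ℂ → E} {σ τ : ℝ}

lemma norm_integral_horizontal_le {φ : ℝ → ℝ}
    (hF : ∀ s : ℂ, s.re ∈ Set.uIcc σ τ → ‖F s‖ ≤ φ |s.im|) (T : ℝ) :
    ‖∫ x in σ..τ, F (x + T * I)‖ ≤ φ |T| * |τ - σ| :=
  intervalIntegral.norm_integral_le_of_norm_le_const fun x hx => by
    simpa using hF (x + T * I) (by simpa using Set.uIoc_subset_uIcc hx)

lemma integral_vertical_eq_of_tendsto_zero {φ : ℝ → ℝ}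
    (hd : ∀ s : ℂ, s.re ∈ Set.uIcc σ τ → DifferentiableAt ℂ F s)
    (hφ : Tendsto φ atTop (𝓝 0)) (hF : ∀ s : ℂ, s.re ∈ Set.uIcc σ τ → ‖F s‖ ≤ φ |s.im|)
    (hσ : VerticalIntegrable F σ) (hτ : VerticalIntegrable F τ) :
    ∫ y : ℝ, F (σ + y * I) = ∫ y : ℝ, F (τ + y * I) := by
  have hrect (T : ℝ) : I • ((∫ y in (-T)..T, F (τ + y * I)) - ∫ y in (-T)..T, F (σ + y * I)) =
      (∫ x in σ..τ, F (x + T * I)) - ∫ x in σ..τ, F (x + (-T : ℝ) * I) := by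
    have h := integral_boundary_rect_eq_zero_of_differentiableOn F ⟨σ, -T⟩ ⟨τ, T⟩
      fun s hs => (hd s hs.1).differentiableWithinAt
    rw [smul_sub, ← sub_eq_zero, ← h]
    abel
  have hnorm : ∀ᶠ T : ℝ in atTop,
      ‖(∫ y in (-T)..T, F (τ + y * I)) - ∫ y in (-T)..T, F (σ + y * I)‖ ≤
        2 * |τ - σ| * φ T := by
    filter_upwards [eventually_ge_atTop 0] with T hT
    have htop := norm_integral_horizontal_le hF T
    have hbot := norm_integral_horizontal_le hF (-T)
    rw [abs_neg] at hbot
    rw [abs_of_nonneg hT] at htop hbot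
    rw [← one_mul ‖_‖, ← norm_I, ← norm_smul, hrect]
    linarith [norm_sub_le (∫ x in σ..τ, F (x + T * I)) (∫ x in σ..τ, F (x + (-T : ℝ) * I))]
  have hzero : Tendsto (fun T : ℝ => (∫ y in (-T)..T, F (τ + y * I)) -
      ∫ y in (-T)..T, F (σ + y * I)) atTop (𝓝 0) :=
    squeeze_zero_norm' hnorm (by simpa using hφ.const_mul (2 * |τ - σ|))
  have hlim := (intervalIntegral_tendsto_integral hτ tendsto_neg_atTop_atBot tendsto_id).sub
    (intervalIntegral_tendsto_integral hσ tendsto_neg_atTop_atBot tendsto_id)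
  exact (sub_eq_zero.mp (tendsto_nhds_unique hlim hzero)).symm

lemma norm_exp_mul_sq (ε : ℝ) (s : ℂ) :
    ‖cexp (ε * s ^ 2)‖ = Real.exp (ε * (s.re ^ 2 - s.im ^ 2)) := by
  rw [norm_exp, re_ofReal_mul, sq s, mul_re, ← sq, ← sq]

lemma norm_exp_mul_sq_vertical_le {ε : ℝ} (hε : 0 ≤ ε) (σ y : ℝ) :
    ‖cexp (ε * (σ + y * I) ^ 2)‖ ≤ Real.exp (ε * σ ^ 2) := by
  rw [norm_exp_mul_sq]
  refine Real.exp_le_exp.mpr (mul_le_mul_of_nonneg_left ?_ hε)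
  simpa using sq_nonneg y

lemma verticalIntegrable_exp_mul_sq_smul {ε : ℝ} (hε : 0 ≤ ε) (h : VerticalIntegrable F σ) :
    VerticalIntegrable (fun s => cexp (ε * s ^ 2) • F s) σ :=
  Integrable.bdd_smul (C := Real.exp (ε * σ ^ 2)) h
    (Continuous.aestronglyMeasurable (by fun_prop))
    (.of_forall fun y => norm_exp_mul_sq_vertical_le hε σ y)

lemma tendsto_integral_exp_mul_sq_smul (h : VerticalIntegrable F σ) :
    Tendsto (fun ε : ℝ => ∫ y : ℝ, cexp (ε * (σ + y * I) ^ 2) • F (σ + y * I)) (𝓝[>] 0)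
      (𝓝 (∫ y : ℝ, F (σ + y * I))) := by
  refine tendsto_integral_filter_of_dominated_convergence
    (fun y => Real.exp (σ ^ 2) * ‖F (σ + y * I)‖) ?_ ?_ (h.norm.const_mul _)
    (.of_forall fun y => ?_)
  · filter_upwards [self_mem_nhdsWithin] with ε hε
    exact (verticalIntegrable_exp_mul_sq_smul (le_of_lt hε) h).aestronglyMeasurable
  · filter_upwards [Ioo_mem_nhdsGT zero_lt_one] with ε hε
    refine .of_forall fun y => ?_
    rw [norm_smul]
    refine mul_le_mul_of_nonneg_right
      ((norm_exp_mul_sq_vertical_le hε.1.le σ y).trans (Real.exp_le_exp.mpr ?_)) (norm_nonneg _)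
    exact mul_le_of_le_one_left (sq_nonneg σ) hε.2.le
  · have hcont : Continuous fun ε : ℝ => cexp (ε * (σ + y * I) ^ 2) • F (σ + y * I) := by fun_prop
    simpa using (hcont.tendsto 0).mono_left nhdsWithin_le_nhds

lemma ExpGrowthOnStrip.exists_norm_exp_mul_sq_smul_le {S : Set ℝ} (hF : ExpGrowthOnStrip S F)
    (hS : Bornology.IsBounded S) {ε : ℝ} (hε : 0 < ε) :
    ∃ φ : ℝ → ℝ, Tendsto φ atTop (𝓝 0) ∧
      ∀ s : ℂ, s.re ∈ S → ‖cexp (ε * s ^ 2) • F s‖ ≤ φ |s.im| := by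
  obtain ⟨C, D, hF⟩ := hF
  obtain ⟨M, hM⟩ := hS.exists_norm_le
  refine ⟨fun T => |C| * Real.exp (ε * M ^ 2) * Real.exp (-(T * (ε * T + -D))), ?_,
    fun s hs => ?_⟩
  · have hquadratic : Tendsto (fun T : ℝ => T * (ε * T + -D)) atTop atTop :=
      tendsto_id.atTop_mul_atTop₀
        (tendsto_atTop_add_const_right _ _ (tendsto_id.const_mul_atTop hε))
    simpa using (Real.tendsto_exp_neg_atTop_nhds_zero.comp hquadratic).const_mul
      (|C| * Real.exp (ε * M ^ 2))
  · have hre : s.re ^ 2 ≤ M ^ 2 := sq_le_sq' (abs_le.mp (hM _ hs)).1 (abs_le.mp (hM _ hs)).2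
    rw [norm_smul, norm_exp_mul_sq]
    calc Real.exp (ε * (s.re ^ 2 - s.im ^ 2)) * ‖F s‖
        ≤ Real.exp (ε * (M ^ 2 - s.im ^ 2)) * (|C| * Real.exp (D * |s.im|)) := by
          gcongr
          exact (hF s hs).trans (mul_le_mul_of_nonneg_right (le_abs_self C) (Real.exp_pos _).le)
      _ = _ := by
          simp only [mul_left_comm _ |C|, mul_assoc, ← Real.exp_add, ← sq_abs s.im]
          ring_nf

theorem integral_vertical_eq (hd : ∀ s : ℂ, s.re ∈ Set.uIcc σ τ → DifferentiableAt ℂ F s)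
    (hF : ExpGrowthOnStrip (Set.uIcc σ τ) F) (hσ : VerticalIntegrable F σ)
    (hτ : VerticalIntegrable F τ) :
    ∫ y : ℝ, F (σ + y * I) = ∫ y : ℝ, F (τ + y * I) := by
  refine tendsto_nhds_unique_of_eventuallyEq (tendsto_integral_exp_mul_sq_smul hσ)
    (tendsto_integral_exp_mul_sq_smul hτ) ?_
  filter_upwards [self_mem_nhdsWithin] with ε hε
  obtain ⟨φ, hφ, hle⟩ := hF.exists_norm_exp_mul_sq_smul_le isCompact_uIcc.isBounded hε
  have hε' : 0 ≤ ε := le_of_lt hε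
  exact integral_vertical_eq_of_tendsto_zero
    (fun s hs => DifferentiableAt.fun_smul (by fun_prop) (hd s hs)) hφ hle
    (verticalIntegrable_exp_mul_sq_smul hε' hσ) (verticalIntegrable_exp_mul_sq_smul hε' hτ)

end VerticalStrips

section GammaGrowth

lemma norm_Gamma_le_Gamma_re {s : ℂ} (hs : 0 < s.re) : ‖Gamma s‖ ≤ Real.Gamma s.re := by
  rw [Gamma_eq_integral hs, Real.Gamma_eq_integral hs, GammaIntegral]
  refine (norm_integral_le_integral_norm _).trans_eq
    (setIntegral_congr_fun measurableSet_Ioi fun x hx => ?_)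
  simp only [norm_mul]
  rw [Complex.norm_of_nonneg (Real.exp_pos _).le, norm_cpow_eq_rpow_re_of_pos hx, sub_re, one_re]

lemma exists_norm_Gamma_le {S : Set ℝ} (hS : IsCompact S) (hpos : ∀ x ∈ S, 0 < x) :
    ∃ C : ℝ, ∀ s : ℂ, s.re ∈ S → ‖Gamma s‖ ≤ C := by
  have hcont : ContinuousOn Real.Gamma S :=
    Real.differentiableOn_Gamma_Ioi.continuousOn.mono hpos
  obtain ⟨C, hC⟩ := hS.exists_bound_of_continuousOn hcont
  exact ⟨C, fun s hs => (norm_Gamma_le_Gamma_re (hpos _ hs)).trans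
    ((le_abs_self _).trans (hC _ hs))⟩

lemma norm_Gamma_le_norm_Gamma_add_natCast {s : ℂ} (hs : 1 ≤ |s.im|) (n : ℕ) :
    ‖Gamma s‖ ≤ ‖Gamma (s + n)‖ := by
  induction n with
  | zero => rw [Nat.cast_zero, add_zero]
  | succ n ih =>
    have hnorm : 1 ≤ ‖s + n‖ := hs.trans (by simpa using abs_im_le_norm (s + n))
    have hne : s + n ≠ 0 := norm_pos_iff.mp (zero_lt_one.trans_le hnorm)
    rw [Nat.cast_succ, ← add_assoc, Gamma_add_one _ hne, norm_mul]
    exact ih.trans (le_mul_of_one_le_left (norm_nonneg _) hnorm)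

lemma exists_norm_Gamma_le_of_one_le_abs_im {S : Set ℝ} (hS : IsCompact S) :
    ∃ C : ℝ, ∀ s : ℂ, s.re ∈ S → 1 ≤ |s.im| → ‖Gamma s‖ ≤ C := by
  obtain ⟨M, hM⟩ := hS.isBounded.exists_norm_le
  obtain ⟨n, hn⟩ := exists_nat_gt M
  obtain ⟨C, hC⟩ := exists_norm_Gamma_le (hS.image (continuous_add_const (n : ℝ))) (by
    rintro _ ⟨x, hx, rfl⟩
    linarith [(abs_le.mp (hM x hx)).1])
  exact ⟨C, fun s hs him => (norm_Gamma_le_norm_Gamma_add_natCast him n).trans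
    (hC _ ⟨s.re, hs, by simp⟩)⟩

lemma norm_sin_le_exp (s : ℂ) : ‖sin s‖ ≤ Real.exp |s.im| := by
  have hneg : ‖cexp (-s * I)‖ ≤ Real.exp |s.im| := by
    rw [norm_exp]
    simpa using le_abs_self s.im
  have hpos : ‖cexp (s * I)‖ ≤ Real.exp |s.im| := by
    rw [norm_exp]
    simpa using neg_le_abs s.im
  rw [sin, norm_div, norm_mul, norm_I, mul_one, norm_ofNat, div_le_iff₀ two_pos]
  linarith [norm_sub_le (cexp (-s * I)) (cexp (s * I))]

lemma inv_Gamma_eq {s : ℂ} (hs : Gamma (1 - s) ≠ 0) :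
    (Gamma s)⁻¹ = Gamma (1 - s) * (sin (Real.pi * s) / Real.pi) := by
  rw [eq_div_of_mul_eq hs (Gamma_mul_Gamma_one_sub s), inv_div, div_div_eq_mul_div, mul_div_assoc]

lemma norm_inv_Gamma_le {s : ℂ} (hs : s.im ≠ 0) :
    ‖(Gamma s)⁻¹‖ ≤ ‖Gamma (1 - s)‖ * Real.exp (Real.pi * |s.im|) := by
  have hne : Gamma (1 - s) ≠ 0 := Gamma_ne_zero fun m h => hs (by simpa using congrArg im h)
  rw [inv_Gamma_eq hne, norm_mul, norm_div, Complex.norm_of_nonneg Real.pi_pos.le]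
  refine mul_le_mul_of_nonneg_left ((div_le_self (norm_nonneg _) ?_).trans ?_) (norm_nonneg _)
  · linarith [Real.pi_gt_three]
  · simpa [abs_mul, abs_of_pos Real.pi_pos] using norm_sin_le_exp (Real.pi * s)

lemma expGrowthOnStrip_inv_Gamma {S : Set ℝ} (hS : IsCompact S) :
    ExpGrowthOnStrip S fun s => (Gamma s)⁻¹ := by
  obtain ⟨C, hC⟩ := exists_norm_Gamma_le_of_one_le_abs_im
    (hS.image (continuous_sub_left (1 : ℝ)))
  obtain ⟨C', hC'⟩ := (hS.reProdIm (isCompact_Icc (a := -1) (b := 1))).exists_bound_of_continuousOn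
    differentiable_one_div_Gamma.continuous.continuousOn
  refine ⟨max C C', Real.pi, fun s hs => ?_⟩
  rcases le_total |s.im| 1 with him | him
  · have hle := (hC' s ⟨hs, abs_le.mp him⟩).trans (le_max_right C C')
    exact hle.trans (le_mul_of_one_le_right ((norm_nonneg _).trans hle)
      (Real.one_le_exp (by positivity)))
  · refine (norm_inv_Gamma_le fun h => ?_).trans (mul_le_mul_of_nonneg_right
      ((hC (1 - s) ⟨s.re, hs, by simp⟩ (by simpa using him)).trans (le_max_left C C'))
      (Real.exp_pos _).le)
    norm_num [h] at him

lemma abs_im_mul_arg (s : ℂ) : |s.im| * |arg s| = s.im * arg s := by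
  rcases le_or_gt 0 s.im with h | h
  · rw [abs_of_nonneg h, abs_of_nonneg (arg_nonneg_iff.mpr h)]
  · rw [abs_of_neg h, abs_of_neg (arg_neg_iff.mpr h), neg_mul_neg]

lemma im_mul_arg_le {s : ℂ} (hs : 0 ≤ s.re) : s.im * arg s ≤ Real.pi / 2 * |s.im| := by
  rw [← abs_im_mul_arg, mul_comm]
  exact mul_le_mul_of_nonneg_right (abs_arg_le_pi_div_two_iff.mpr hs) (abs_nonneg _)

lemma le_im_mul_arg {s : ℂ} (hs : 0 < s.re) : Real.pi / 2 * |s.im| - s.re ≤ s.im * arg s := by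
  rw [← abs_im_mul_arg]
  rcases eq_or_ne s.im 0 with h | h
  · simp [h, hs.le]
  have him : 0 < |s.im| := abs_pos.mpr h
  have hne : s ≠ 0 := fun h0 => h (by simp [h0])
  have harg : 0 < |arg s| := abs_pos.mpr fun h0 => h (arg_eq_zero_iff.mp h0).2
  have hlt : |arg s| < Real.pi / 2 := abs_arg_lt_pi_div_two_iff.mpr (Or.inl hs)
  have htan : Real.tan (Real.pi / 2 - |arg s|) = s.re / |s.im| := by
    have hsin : Real.sin |arg s| = |s.im| / ‖s‖ := by
      rw [← Real.abs_sin_eq_sin_abs_of_abs_le_pi (abs_arg_le_pi s), sin_arg, abs_div, abs_norm]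
    rw [Real.tan_pi_div_two_sub, Real.tan_eq_sin_div_cos, hsin, Real.cos_abs, cos_arg hne, inv_div,
      div_div_div_cancel_right₀ (norm_ne_zero_iff.mpr hne)]
  have hle := Real.le_tan (x := Real.pi / 2 - |arg s|) (by linarith) (by linarith)
  rw [htan, le_div_iff₀ him] at hle
  linarith

end GammaGrowth

section Stirling

/-- `Γ(s) s ^ (1 / 2 - s)`, which Stirling's formula compares with `√(2π) e ^ (-s)`; it is bounded
on `1 / 2 ≤ Re s ≤ 3 / 2`. -/
noncomputable def stirlingQuotient (s : ℂ) : ℂ :=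
  Gamma s * s ^ (1 / 2 - s)

lemma norm_stirlingQuotient {s : ℂ} (hs : s ≠ 0) :
    ‖stirlingQuotient s‖ = ‖Gamma s‖ * (‖s‖ ^ (1 / 2 - s.re) * Real.exp (s.im * arg s)) := by
  have hre : (1 / 2 - s : ℂ).re = 1 / 2 - s.re := by norm_num
  have him : (1 / 2 - s : ℂ).im = -s.im := by norm_num
  rw [stirlingQuotient, norm_mul, norm_cpow_of_ne_zero hs, hre, him, div_eq_mul_inv,
    ← Real.exp_neg, mul_neg, neg_neg, mul_comm (arg s)]

lemma norm_sq_Gamma_half_add (y : ℝ) :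
    ‖Gamma (1 / 2 + y * I)‖ ^ 2 = Real.pi / Real.cosh (Real.pi * y) := by
  have hconj : (1 : ℂ) - (1 / 2 + y * I) = starRingEnd ℂ (1 / 2 + y * I) := by
    simp only [map_add, map_div₀, map_one, map_ofNat, map_mul, conj_ofReal, conj_I]
    ring
  have hsin : sin (Real.pi * (1 / 2 + y * I)) = Real.cosh (Real.pi * y) := by
    rw [show (Real.pi : ℂ) * (1 / 2 + y * I) = ((Real.pi * y : ℝ) : ℂ) * I + Real.pi / 2 by
      push_cast; ring, sin_add_pi_div_two, cos_mul_I, ofReal_cosh]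
  have h := Gamma_mul_Gamma_one_sub (1 / 2 + y * I)
  rw [hconj, Gamma_conj, mul_conj, hsin, normSq_eq_norm_sq] at h
  exact_mod_cast h

lemma half_exp_abs_le_cosh (x : ℝ) : Real.exp |x| / 2 ≤ Real.cosh x := by
  rw [← Real.cosh_abs, Real.cosh_eq]
  linarith [Real.exp_pos (-|x|)]

lemma norm_Gamma_le_of_re_eq_half {s : ℂ} (hs : s.re = 1 / 2) :
    ‖Gamma s‖ ≤ √(2 * Real.pi) * Real.exp (-(Real.pi / 2 * |s.im|)) := by
  have hcosh := half_exp_abs_le_cosh (Real.pi * s.im)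
  rw [abs_mul, abs_of_pos Real.pi_pos] at hcosh
  have hs' : s = 1 / 2 + s.im * I := by
    conv_lhs => rw [← re_add_im s, hs]
    norm_num
  refine (sq_le_sq₀ (norm_nonneg _) (by positivity)).mp ?_
  rw [hs', norm_sq_Gamma_half_add, ← hs', mul_pow, Real.sq_sqrt (by positivity), ← Real.exp_nat_mul]
  refine (div_le_div_of_nonneg_left Real.pi_pos.le (by positivity) hcosh).trans_eq ?_
  rw [show ((2 : ℕ) : ℝ) * -(Real.pi / 2 * |s.im|) = -(Real.pi * |s.im|) by push_cast; ring,
    Real.exp_neg]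
  ring

lemma norm_stirlingQuotient_le_of_norm_Gamma_le {s : ℂ} (hs : 0 < s.re) {C : ℝ}
    (h : ‖Gamma s‖ * ‖s‖ ^ (1 / 2 - s.re) ≤ C * Real.exp (-(Real.pi / 2 * |s.im|))) :
    ‖stirlingQuotient s‖ ≤ C := by
  rw [norm_stirlingQuotient (ne_zero_of_re_pos hs), ← mul_assoc]
  refine (mul_le_mul h (Real.exp_le_exp.mpr (im_mul_arg_le hs.le)) (Real.exp_pos _).le
    ((by positivity : (0 : ℝ) ≤ _).trans h)).trans_eq ?_
  rw [mul_assoc, ← Real.exp_add, neg_add_cancel, Real.exp_zero, mul_one]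

lemma norm_stirlingQuotient_le_of_re_eq_half {s : ℂ} (hs : s.re = 1 / 2) :
    ‖stirlingQuotient s‖ ≤ √(2 * Real.pi) := by
  refine norm_stirlingQuotient_le_of_norm_Gamma_le (by rw [hs]; norm_num) ?_
  rw [hs, sub_self, Real.rpow_zero, mul_one]
  exact norm_Gamma_le_of_re_eq_half hs

lemma norm_stirlingQuotient_le_of_re_eq_three_halves {s : ℂ} (hs : s.re = 3 / 2) :
    ‖stirlingQuotient s‖ ≤ √(2 * Real.pi) := by
  have hre : 0 < s.re := by rw [hs]; norm_num
  have hre_sub : (s - 1).re = 1 / 2 := by rw [sub_re, hs, one_re]; norm_num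
  have him : (s - 1).im = s.im := by rw [sub_im, one_im, sub_zero]
  have hΓ : Gamma s = (s - 1) * Gamma (s - 1) := by
    rw [← Gamma_add_one _ (ne_zero_of_re_pos (by rw [hre_sub]; norm_num)), sub_add_cancel]
  have hle : ‖s - 1‖ ≤ ‖s‖ := by
    rw [← sq_le_sq₀ (norm_nonneg _) (norm_nonneg _), ← normSq_eq_norm_sq, ← normSq_eq_norm_sq,
      normSq_apply, normSq_apply, hre_sub, him, hs]
    linarith
  have hpos : 0 < ‖s‖ := norm_pos_iff.mpr (ne_zero_of_re_pos hre)
  refine norm_stirlingQuotient_le_of_norm_Gamma_le hre ?_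
  calc ‖Gamma s‖ * ‖s‖ ^ (1 / 2 - s.re) = ‖s - 1‖ / ‖s‖ * ‖Gamma (s - 1)‖ := by
        rw [hΓ, norm_mul, hs, show (1 / 2 - 3 / 2 : ℝ) = -1 by norm_num, Real.rpow_neg_one]
        ring
    _ ≤ ‖Gamma (s - 1)‖ := mul_le_of_le_one_left (norm_nonneg _) ((div_le_one hpos).mpr hle)
    _ ≤ _ := him ▸ norm_Gamma_le_of_re_eq_half hre_sub

lemma expGrowthOnStrip_stirlingQuotient :
    ExpGrowthOnStrip (Set.Ioo (1 / 2) (3 / 2)) stirlingQuotient := by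
  obtain ⟨C, hC⟩ := exists_norm_Gamma_le (isCompact_Icc (a := (1 / 2 : ℝ)) (b := 3 / 2))
    fun x hx => one_half_pos.trans_le hx.1
  refine ⟨C * 2, Real.pi / 2, fun s hs => ?_⟩
  have hre : 0 < s.re := one_half_pos.trans hs.1
  have hΓ := hC s (Set.Ioo_subset_Icc_self hs)
  have hrpow : ‖s‖ ^ (1 / 2 - s.re) ≤ 2 := by
    calc ‖s‖ ^ (1 / 2 - s.re) ≤ (1 / 2 : ℝ) ^ (1 / 2 - s.re) :=
          Real.rpow_le_rpow_of_nonpos one_half_pos (hs.1.le.trans (re_le_norm s))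
            (sub_nonpos.mpr hs.1.le)
      _ ≤ (1 / 2 : ℝ) ^ (-1 : ℝ) :=
          Real.rpow_le_rpow_of_exponent_ge one_half_pos one_half_lt_one.le (by linarith [hs.2])
      _ = 2 := by rw [Real.rpow_neg_one, one_div, inv_inv]
  rw [norm_stirlingQuotient (ne_zero_of_re_pos hre), ← mul_assoc]
  exact mul_le_mul (mul_le_mul hΓ hrpow (by positivity) ((norm_nonneg _).trans hΓ))
    (Real.exp_le_exp.mpr (im_mul_arg_le hre.le)) (Real.exp_pos _).le
    (mul_nonneg ((norm_nonneg _).trans hΓ) two_pos.le)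

lemma differentiableAt_Gamma_of_re_pos {s : ℂ} (hs : 0 < s.re) : DifferentiableAt ℂ Gamma s :=
  differentiableAt_Gamma s fun m h => by
    rw [h, neg_re, natCast_re, Left.neg_pos_iff] at hs
    exact hs.not_ge m.cast_nonneg

lemma differentiableAt_stirlingQuotient {s : ℂ} (hs : 0 < s.re) :
    DifferentiableAt ℂ stirlingQuotient s :=
  (differentiableAt_Gamma_of_re_pos hs).mul
    (differentiableAt_id.cpow (by fun_prop) (Or.inl hs))

lemma norm_stirlingQuotient_le {s : ℂ} (hs : s.re ∈ Set.Icc (1 / 2) (3 / 2)) :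
    ‖stirlingQuotient s‖ ≤ √(2 * Real.pi) := by
  have hd : DiffContOnCl ℂ stirlingQuotient (re ⁻¹' Set.Ioo (1 / 2) (3 / 2)) := by
    refine DifferentiableOn.diffContOnCl fun z hz => ?_
    rw [closure_preimage_re, closure_Ioo (by norm_num)] at hz
    exact (differentiableAt_stirlingQuotient (one_half_pos.trans_le hz.1)).differentiableWithinAt
  exact expGrowthOnStrip_stirlingQuotient.norm_le_of_boundary hd
    (fun z hz => norm_stirlingQuotient_le_of_re_eq_half hz)
    (fun z hz => norm_stirlingQuotient_le_of_re_eq_three_halves hz) hs.1 hs.2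

lemma norm_Gamma_le_of_re_mem_Icc {s : ℂ} (hs : s.re ∈ Set.Icc (1 / 2) (3 / 2)) :
    ‖Gamma s‖ ≤ √(2 * Real.pi) * Real.exp s.re *
      (‖s‖ ^ (s.re - 1 / 2) * Real.exp (-(Real.pi / 2) * |s.im|)) := by
  have hre : 0 < s.re := one_half_pos.trans_le hs.1
  have hpos : 0 < ‖s‖ := norm_pos_iff.mpr (ne_zero_of_re_pos hre)
  have hle := norm_stirlingQuotient_le hs
  rw [norm_stirlingQuotient (ne_zero_of_re_pos hre), ← le_div_iff₀ (by positivity)] at hle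
  refine hle.trans ?_
  rw [div_eq_mul_inv, mul_inv, ← Real.rpow_neg hpos.le, neg_sub, ← Real.exp_neg, mul_assoc,
    mul_left_comm (Real.exp s.re), ← Real.exp_add]
  gcongr
  linarith [le_im_mul_arg hre]

end Stirling

section VerticalAsymptotics

open Filter Asymptotics

/-- The model function `(1 + |y|) ^ e * exp (d |y|)` for the growth of a gamma quotient along a
vertical line. -/
noncomputable def verticalModel (e d y : ℝ) : ℝ :=
  (1 + |y|) ^ e * Real.exp (d * |y|)

lemma verticalModel_pos (e d y : ℝ) : 0 < verticalModel e d y := by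
  unfold verticalModel
  positivity

lemma verticalModel_zero_zero (y : ℝ) : verticalModel 0 0 y = 1 := by
  rw [verticalModel, Real.rpow_zero, zero_mul, Real.exp_zero, mul_one]

lemma verticalModel_one_zero (y : ℝ) : verticalModel 1 0 y = 1 + |y| := by
  rw [verticalModel, Real.rpow_one, zero_mul, Real.exp_zero, mul_one]

lemma verticalModel_zero_left (d y : ℝ) : verticalModel 0 d y = Real.exp (d * |y|) := by
  rw [verticalModel, Real.rpow_zero, one_mul]

lemma verticalModel_mul (e d e' d' y : ℝ) :
    verticalModel e d y * verticalModel e' d' y = verticalModel (e + e') (d + d') y := by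
  rw [verticalModel, verticalModel, verticalModel, Real.rpow_add (by positivity), add_mul,
    Real.exp_add, mul_mul_mul_comm]

lemma verticalModel_inv (e d y : ℝ) :
    (verticalModel e d y)⁻¹ = verticalModel (-e) (-d) y := by
  rw [verticalModel, verticalModel, Real.rpow_neg (by positivity), neg_mul, Real.exp_neg, mul_inv]

lemma verticalModel_neg (e d y : ℝ) : verticalModel e d (-y) = verticalModel e d y := by
  rw [verticalModel, verticalModel, abs_neg]

lemma verticalModel_list_prod {ι : Type*} (l : List ι) (e d : ι → ℝ) (y : ℝ) :
    (l.map fun i => verticalModel (e i) (d i) y).prod =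
      verticalModel (l.map e).sum (l.map d).sum y := by
  induction l with
  | nil => exact (verticalModel_zero_zero y).symm
  | cons i l ih =>
    rw [List.map_cons, List.prod_cons, ih, verticalModel_mul, List.map_cons, List.map_cons,
      List.sum_cons, List.sum_cons]

lemma isBigO_exp_mul_abs_add (d v : ℝ) (l : Filter ℝ) :
    (fun y : ℝ => Real.exp (d * |v + y|)) =O[l] fun y => Real.exp (d * |y|) := by
  refine .of_bound (Real.exp (|d| * |v|)) (.of_forall fun y => ?_)
  rw [Real.norm_of_nonneg (Real.exp_pos _).le, Real.norm_of_nonneg (Real.exp_pos _).le,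
    ← Real.exp_add]
  have habs : |(|v + y| - |y|)| ≤ |v| := by simpa using abs_abs_sub_abs_le_abs_sub (v + y) y
  have hmul : d * (|v + y| - |y|) ≤ |d| * |v| :=
    (le_abs_self _).trans ((abs_mul _ _).trans_le (mul_le_mul_of_nonneg_left habs (abs_nonneg d)))
  exact Real.exp_le_exp.mpr (by linarith)

lemma isLittleO_const_cocompact {E : Type*} [NormedAddCommGroup E] (c : E) :
    (fun _ : ℝ => c) =o[cocompact ℝ] fun y : ℝ => y :=
  isLittleO_const_left.mpr (.inr (tendsto_norm_cocompact_atTop (E := ℝ)))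

lemma isTheta_add_mul_I (u : ℂ) :
    (fun y : ℝ => u + y * I) =Θ[cocompact ℝ] verticalModel 1 0 := by
  have hleft : (fun y : ℝ => (y : ℂ) * I) =Θ[cocompact ℝ] fun y : ℝ => y :=
    .of_norm_eventuallyEq_norm (.of_forall fun y => by simp)
  have hright : (fun y : ℝ => |y|) =Θ[cocompact ℝ] fun y : ℝ => y :=
    .of_norm_eventuallyEq_norm (.of_forall fun y => by simp)
  rw [funext verticalModel_one_zero]
  simp only [add_comm u, add_comm (1 : ℝ)]
  exact (hleft.add_isLittleO (isLittleO_const_cocompact u)).trans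
    (hright.add_isLittleO (isLittleO_const_cocompact 1)).symm

lemma eventually_im_add_mul_I_ne_zero (u : ℂ) :
    ∀ᶠ y : ℝ in cocompact ℝ, (u + y * I).im ≠ 0 :=
  mem_of_superset (isCompact_singleton (x := -u.im)).compl_mem_cocompact fun y hy h =>
    hy (eq_neg_of_add_eq_zero_right (by simpa using h))

lemma isBigO_Gamma_vertical_of_re_mem_Icc {u : ℂ} (hu : u.re ∈ Set.Icc (1 / 2) (3 / 2)) :
    (fun y : ℝ => Gamma (u + y * I)) =O[cocompact ℝ]
      verticalModel (u.re - 1 / 2) (-(Real.pi / 2)) := by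
  have hpow : (fun y : ℝ => ‖u + y * I‖ ^ (u.re - 1 / 2)) =O[cocompact ℝ]
      fun y : ℝ => (1 + |y|) ^ (u.re - 1 / 2) := by
    refine (isTheta_add_mul_I u).isBigO.norm_left.rpow (sub_nonneg.mpr hu.1)
      (.of_forall fun y => (verticalModel_pos 1 0 y).le) |>.congr_right fun y => ?_
    rw [verticalModel_one_zero]
  refine IsBigO.trans ?_ (hpow.mul (isBigO_exp_mul_abs_add (-(Real.pi / 2)) u.im _))
  refine .of_bound (√(2 * Real.pi) * Real.exp u.re) (.of_forall fun y => ?_)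
  have hre : (u + y * I).re = u.re := by simp
  have him : (u + y * I).im = u.im + y := by simp
  have h := norm_Gamma_le_of_re_mem_Icc (hre.symm ▸ hu)
  rw [hre, him] at h
  rwa [Real.norm_of_nonneg (by positivity)]

lemma isBigO_Gamma_vertical_add_one_iff (u : ℂ) :
    (fun y : ℝ => Gamma (u + 1 + y * I)) =O[cocompact ℝ]
        verticalModel ((u + 1).re - 1 / 2) (-(Real.pi / 2)) ↔
      (fun y : ℝ => Gamma (u + y * I)) =O[cocompact ℝ]
        verticalModel (u.re - 1 / 2) (-(Real.pi / 2)) := by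
  have hne : ∀ᶠ y : ℝ in cocompact ℝ, u + y * I ≠ 0 :=
    (eventually_im_add_mul_I_ne_zero u).mono fun y hy h => hy (by rw [h, zero_im])
  have hrec : (fun y : ℝ => Gamma (u + 1 + y * I)) =ᶠ[cocompact ℝ]
      fun y : ℝ => (u + y * I) * Gamma (u + y * I) :=
    hne.mono fun y hy => (add_right_comm u _ _ ▸ Gamma_add_one _ hy :)
  have hmodel (y : ℝ) : verticalModel ((u + 1).re - 1 / 2) (-(Real.pi / 2)) y =
      verticalModel 1 0 y * verticalModel (u.re - 1 / 2) (-(Real.pi / 2)) y := by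
    rw [verticalModel_mul, add_re, one_re, zero_add, ← add_sub_assoc, add_comm u.re]
  rw [funext hmodel]
  refine ⟨fun h => ?_, fun h => hrec.trans_isBigO ((isTheta_add_mul_I u).isBigO.mul h)⟩
  refine ((isTheta_add_mul_I u).inv.isBigO.mul (hrec.symm.trans_isBigO h)).congr' ?_ ?_
  · exact hne.mono fun y hy => inv_mul_cancel_left₀ hy _
  · exact .of_forall fun y => inv_mul_cancel_left₀ (verticalModel_pos 1 0 y).ne' _

lemma isBigO_Gamma_vertical (u : ℂ) :
    (fun y : ℝ => Gamma (u + y * I)) =O[cocompact ℝ]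
      verticalModel (u.re - 1 / 2) (-(Real.pi / 2)) := by
  have hper : Function.Periodic (fun x : ℝ => ∀ u : ℂ, u.re = x →
      (fun y : ℝ => Gamma (u + y * I)) =O[cocompact ℝ]
        verticalModel (u.re - 1 / 2) (-(Real.pi / 2))) 1 := fun x => propext
    ⟨fun h u hu => (isBigO_Gamma_vertical_add_one_iff u).mp (h _ (by rw [add_re, hu, one_re])),
      fun h u hu => by
        have h' := (isBigO_Gamma_vertical_add_one_iff (u - 1)).mpr
          (h _ (by rw [sub_re, hu, one_re, add_sub_cancel_right]))
        rwa [sub_add_cancel] at h'⟩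
  obtain ⟨x, hx, h⟩ := hper.exists_mem_Ico one_pos u.re (1 / 2)
  refine h.mpr (fun v hv => isBigO_Gamma_vertical_of_re_mem_Icc ?_) u rfl
  rw [hv]
  exact ⟨hx.1, by linarith [hx.2]⟩

lemma tendsto_neg_cocompact : Tendsto (fun y : ℝ => -y) (cocompact ℝ) (cocompact ℝ) :=
  (Homeomorph.neg ℝ).isClosedEmbedding.tendsto_cocompact

lemma isBigO_inv_Gamma_vertical (u : ℂ) :
    (fun y : ℝ => (Gamma (u + y * I))⁻¹) =O[cocompact ℝ]
      fun y => (verticalModel (u.re - 1 / 2) (-(Real.pi / 2)) y)⁻¹ := by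
  have hreflect : (fun y : ℝ => (Gamma (u + y * I))⁻¹) =O[cocompact ℝ] fun y : ℝ =>
      ‖Gamma (1 - u + (-y : ℝ) * I)‖ * Real.exp (Real.pi * |u.im + y|) := by
    refine .of_norm_eventuallyLE ((eventually_im_add_mul_I_ne_zero u).mono fun y hy => ?_)
    have h := norm_inv_Gamma_le hy
    rwa [show (1 : ℂ) - (u + y * I) = 1 - u + (-y : ℝ) * I by push_cast; ring,
      show (u + y * I).im = u.im + y by simp] at h
  refine (hreflect.trans (((isBigO_Gamma_vertical (1 - u)).comp_tendsto
    tendsto_neg_cocompact).norm_left.mul (isBigO_exp_mul_abs_add Real.pi u.im _))).congr_right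
    fun y => ?_
  rw [Function.comp_apply, verticalModel_neg, ← verticalModel_zero_left, verticalModel_mul,
    verticalModel_inv, sub_re, one_re]
  congr 1 <;> ring

theorem isTheta_Gamma_vertical (u : ℂ) :
    (fun y : ℝ => Gamma (u + y * I)) =Θ[cocompact ℝ]
      verticalModel (u.re - 1 / 2) (-(Real.pi / 2)) := by
  refine ⟨isBigO_Gamma_vertical u, ?_⟩
  refine ((isBigO_inv_Gamma_vertical u).inv_rev ?_).congr (fun _ => inv_inv _) fun _ => inv_inv _
  filter_upwards [eventually_im_add_mul_I_ne_zero u] with y hy h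
  refine absurd (inv_eq_zero.mp h) (Gamma_ne_zero fun m hm => hy ?_)
  rw [hm, neg_im, natCast_im, neg_zero]

lemma isTheta_Gamma_sub_vertical (u : ℂ) :
    (fun y : ℝ => Gamma (u - y * I)) =Θ[cocompact ℝ]
      verticalModel (u.re - 1 / 2) (-(Real.pi / 2)) := by
  have h := isTheta_Gamma_vertical u
  have hneg : (fun y : ℝ => Gamma (u + (-y : ℝ) * I)) =Θ[cocompact ℝ]
      fun y => verticalModel (u.re - 1 / 2) (-(Real.pi / 2)) (-y) :=
    ⟨h.isBigO.comp_tendsto tendsto_neg_cocompact,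
      h.symm.isBigO.comp_tendsto tendsto_neg_cocompact⟩
  simpa only [verticalModel_neg, ofReal_neg, neg_mul, ← sub_eq_add_neg] using hneg

lemma list_sum_map_mul_re_add (l : List ℂ) (c d : ℝ) :
    (l.map fun b => c * b.re + d).sum = c * l.sum.re + l.length * d := by
  induction l with
  | nil => simp
  | cons b l ih =>
    rw [List.map_cons, List.sum_cons, ih, List.sum_cons, add_re, List.length_cons, Nat.cast_succ]
    ring

lemma isTheta_list_prod_Gamma_add (l : List ℂ) (γ : ℝ) :
    (fun y : ℝ => (l.map fun b => Gamma (b + (γ + y * I))).prod) =Θ[cocompact ℝ]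
      verticalModel (l.sum.re + l.length * (γ - 1 / 2)) (-(Real.pi / 2) * l.length) := by
  have hsum : (l.map fun b => (b + γ : ℂ).re - 1 / 2).sum =
      l.sum.re + l.length * (γ - 1 / 2) := by
    rw [← one_mul l.sum.re, ← list_sum_map_mul_re_add]
    simp only [one_mul, add_re, ofReal_re, add_sub_assoc]
  have h := IsTheta.listProd (L := l) fun b _ => isTheta_Gamma_vertical (b + γ)
  simpa only [verticalModel_list_prod, add_assoc, hsum, List.map_const', List.sum_replicate,
    nsmul_eq_mul, mul_comm (l.length : ℝ) (-_)] using h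

lemma isTheta_list_prod_Gamma_sub (l : List ℂ) (γ : ℝ) :
    (fun y : ℝ => (l.map fun a => Gamma (1 - a - (γ + y * I))).prod) =Θ[cocompact ℝ]
      verticalModel (-l.sum.re + l.length * (1 / 2 - γ)) (-(Real.pi / 2) * l.length) := by
  have hsum : (l.map fun a => (1 - a - γ : ℂ).re - 1 / 2).sum =
      -l.sum.re + l.length * (1 / 2 - γ) := by
    rw [← neg_one_mul l.sum.re, ← list_sum_map_mul_re_add]
    congr 2 with a
    simp only [sub_re, one_re, ofReal_re]
    ring
  have h := IsTheta.listProd (L := l) fun a _ => isTheta_Gamma_sub_vertical (1 - a - γ)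
  simpa only [verticalModel_list_prod, ← sub_sub, hsum, List.map_const', List.sum_replicate,
    nsmul_eq_mul, mul_comm (l.length : ℝ) (-_)] using h

theorem isTheta_meijerKernel_vertical (a₁ a₂ b₁ b₂ : List ℂ) (γ : ℝ) :
    (fun y : ℝ => meijerKernel a₁ a₂ b₁ b₂ (γ + y * I)) =Θ[cocompact ℝ]
      verticalModel ((((b₁ ++ b₂).length : ℝ) - (a₁ ++ a₂).length) * γ +
        (meijerMu a₁ a₂ b₁ b₂).re - 1) (-(Real.pi * meijerC a₁ a₂ b₁ b₂)) := by
  have h := ((isTheta_list_prod_Gamma_add b₁ γ).mul (isTheta_list_prod_Gamma_sub a₁ γ)).div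
    ((isTheta_list_prod_Gamma_add a₂ γ).mul (isTheta_list_prod_Gamma_sub b₂ γ))
  refine h.trans_eventuallyEq (.of_forall fun y => ?_)
  simp only [verticalModel_mul, div_eq_mul_inv, verticalModel_inv]
  congr 1
  · simp only [meijerMu, List.sum_append, List.length_append, Nat.cast_add, add_re, sub_re,
      one_re, div_ofNat_re, natCast_re]
    ring
  · simp only [meijerC, List.length_append, Nat.cast_add]
    ring

end VerticalAsymptotics

section Kernels

lemma differentiableAt_list_prod_map {ι : Type*} {l : List ι} {f : ι → ℂ → ℂ} {s : ℂ}
    (h : ∀ i ∈ l, DifferentiableAt ℂ (f i) s) :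
    DifferentiableAt ℂ (fun s => (l.map fun i => f i s).prod) s := by
  induction l with
  | nil => simp only [List.map_nil, List.prod_nil, differentiableAt_const]
  | cons i l ih =>
    rw [List.forall_mem_cons] at h
    simpa only [List.map_cons, List.prod_cons] using h.1.fun_mul (ih h.2)

lemma expGrowthOnStrip_exp_mul {S : Set ℝ} (hS : Bornology.IsBounded S) (k : ℂ) :
    ExpGrowthOnStrip S fun s => cexp (k * s) := by
  obtain ⟨M, hM⟩ := hS.exists_norm_le
  refine ⟨Real.exp (‖k‖ * M), ‖k‖, fun s hs => ?_⟩
  rw [norm_exp, ← Real.exp_add, ← mul_add]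
  refine Real.exp_le_exp.mpr ((re_le_norm _).trans ?_)
  rw [norm_mul]
  gcongr
  exact (norm_le_abs_re_add_abs_im s).trans (add_le_add_left (hM _ hs) _)

lemma expGrowthOnStrip_Gamma_affine {S : Set ℝ} (hS : IsCompact S) {u : ℂ} {c : ℝ}
    (hpos : ∀ x ∈ S, 0 < u.re + c * x) : ExpGrowthOnStrip S fun s => Gamma (u + c * s) := by
  obtain ⟨C, hC⟩ := exists_norm_Gamma_le (hS.image (f := fun x => u.re + c * x) (by fun_prop))
    (Set.forall_mem_image.mpr hpos)
  exact .comp_affine u c (.of_norm_le hC)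

lemma expGrowthOnStrip_inv_Gamma_affine {S : Set ℝ} (hS : IsCompact S) (u : ℂ) (c : ℝ) :
    ExpGrowthOnStrip S fun s => (Gamma (u + c * s))⁻¹ :=
  .comp_affine u c (expGrowthOnStrip_inv_Gamma (hS.image (by fun_prop)))

/-- The abscissas `γ` for which the line `Re s = γ` has the poles of all `Γ(b + B s)`,
`(b, B) ∈ b₁`, on its left and those of all `Γ(1 - a - A s)`, `(a, A) ∈ a₁`, on its right (when
the `A`, `B` are positive). -/
def poleSeparators (a₁ b₁ : List (ℂ × ℝ)) : Set ℝ :=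
  {γ | (∀ b ∈ b₁, 0 < b.1.re + b.2 * γ) ∧ ∀ a ∈ a₁, 0 < 1 - a.1.re - a.2 * γ}

lemma add_mul_pos_of_mem_Icc {u c x y t : ℝ} (hx : 0 < u + c * x) (hy : 0 < u + c * y)
    (ht : t ∈ Set.Icc x y) : 0 < u + c * t := by
  rcases le_total 0 c with hc | hc
  · linarith [mul_le_mul_of_nonneg_left ht.1 hc]
  · linarith [mul_le_mul_of_nonpos_left ht.2 hc]

lemma ordConnected_poleSeparators (a₁ b₁ : List (ℂ × ℝ)) :
    (poleSeparators a₁ b₁).OrdConnected where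
  out' x hx y hy t ht := by
    refine ⟨fun b hb => add_mul_pos_of_mem_Icc (hx.1 b hb) (hy.1 b hb) ht, fun a ha => ?_⟩
    have hax := hx.2 a ha
    have hay := hy.2 a ha
    rw [sub_eq_add_neg, ← neg_mul] at hax hay ⊢
    exact add_mul_pos_of_mem_Icc hax hay ht

lemma forall_mem_withOne {l : List ℂ} {p : ℂ × ℝ → Prop} :
    (∀ c ∈ withOne l, p c) ↔ ∀ c ∈ l, p (c, 1) :=
  List.forall_mem_map

lemma mem_poleSeparators_withOne {a₁ b₁ : List ℂ} {γ : ℝ} :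
    γ ∈ poleSeparators (withOne a₁) (withOne b₁) ↔
      (∀ b ∈ b₁, 0 < b.re + γ) ∧ ∀ a ∈ a₁, 0 < 1 - a.re - γ := by
  simp only [poleSeparators, Set.mem_ofPred_eq, forall_mem_withOne, one_mul]

lemma foxKernel_eq_prod_mul_prod_inv (a₁ a₂ b₁ b₂ : List (ℂ × ℝ)) (s : ℂ) :
    foxKernel a₁ a₂ b₁ b₂ s =
      ((b₁.map fun b => Gamma (b.1 + b.2 * s)).prod *
        (a₁.map fun a => Gamma (1 - a.1 + (-a.2 : ℝ) * s)).prod) *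
      ((a₂.map fun a => (Gamma (a.1 + a.2 * s))⁻¹).prod *
        (b₂.map fun b => (Gamma (1 - b.1 + (-b.2 : ℝ) * s))⁻¹).prod) := by
  rw [foxKernel, div_eq_mul_inv, mul_inv, List.prod_inv, List.prod_inv, List.map_map, List.map_map]
  simp only [Function.comp_def, ofReal_neg, neg_mul, sub_eq_add_neg]

lemma meijerKernel_eq_foxKernel (a₁ a₂ b₁ b₂ : List ℂ) :
    meijerKernel a₁ a₂ b₁ b₂ =
      foxKernel (withOne a₁) (withOne a₂) (withOne b₁) (withOne b₂) := by
  ext s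
  simp only [meijerKernel, foxKernel, withOne, List.map_map, Function.comp_def, ofReal_one, one_mul]

lemma differentiableAt_Gamma_affine {u : ℂ} {c : ℝ} {s : ℂ} (h : 0 < u.re + c * s.re) :
    DifferentiableAt ℂ (fun s => Gamma (u + c * s)) s :=
  (differentiableAt_Gamma_of_re_pos (by simpa using h)).comp s
    (f := fun s : ℂ => u + c * s) (by fun_prop)

lemma differentiableAt_inv_Gamma_affine (u : ℂ) (c : ℝ) (s : ℂ) :
    DifferentiableAt ℂ (fun s => (Gamma (u + c * s))⁻¹) s :=
  (differentiable_one_div_Gamma _).comp s (f := fun s : ℂ => u + c * s) (by fun_prop)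

variable {a₁ a₂ b₁ b₂ : List (ℂ × ℝ)}

lemma differentiableAt_foxKernel {s : ℂ} (hs : s.re ∈ poleSeparators a₁ b₁) :
    DifferentiableAt ℂ (foxKernel a₁ a₂ b₁ b₂) s := by
  rw [funext (foxKernel_eq_prod_mul_prod_inv a₁ a₂ b₁ b₂)]
  refine ((differentiableAt_list_prod_map fun b hb => ?_).mul
    (differentiableAt_list_prod_map fun a ha => ?_)).mul
    ((differentiableAt_list_prod_map fun a _ => ?_).mul
      (differentiableAt_list_prod_map fun b _ => ?_))
  · exact differentiableAt_Gamma_affine (hs.1 b hb)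
  · exact differentiableAt_Gamma_affine (by simpa [← sub_eq_add_neg] using hs.2 a ha)
  · exact differentiableAt_inv_Gamma_affine _ _ _
  · exact differentiableAt_inv_Gamma_affine _ _ _

lemma expGrowthOnStrip_foxKernel {S : Set ℝ} (hS : IsCompact S) (hsub : S ⊆ poleSeparators a₁ b₁) :
    ExpGrowthOnStrip S (foxKernel a₁ a₂ b₁ b₂) := by
  rw [funext (foxKernel_eq_prod_mul_prod_inv a₁ a₂ b₁ b₂)]
  refine ((ExpGrowthOnStrip.list_prod fun b hb => ?_).mul (.list_prod fun a ha => ?_)).mul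
    ((ExpGrowthOnStrip.list_prod fun a _ => ?_).mul (.list_prod fun b _ => ?_))
  · exact expGrowthOnStrip_Gamma_affine hS fun x hx => (hsub hx).1 b hb
  · exact expGrowthOnStrip_Gamma_affine hS fun x hx => by
      simpa [← sub_eq_add_neg] using (hsub hx).2 a ha
  · exact expGrowthOnStrip_inv_Gamma_affine hS _ _
  · exact expGrowthOnStrip_inv_Gamma_affine hS _ _

lemma lineIntegral_foxKernel_mul_exp_eq {k : ℂ} {σ τ : ℝ} (hσ : σ ∈ poleSeparators a₁ b₁)
    (hτ : τ ∈ poleSeparators a₁ b₁)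
    (hintσ : VerticalIntegrable (fun s => foxKernel a₁ a₂ b₁ b₂ s * cexp (k * s)) σ)
    (hintτ : VerticalIntegrable (fun s => foxKernel a₁ a₂ b₁ b₂ s * cexp (k * s)) τ) :
    lineIntegral (fun s => foxKernel a₁ a₂ b₁ b₂ s * cexp (k * s)) σ =
      lineIntegral (fun s => foxKernel a₁ a₂ b₁ b₂ s * cexp (k * s)) τ := by
  have hsub := (ordConnected_poleSeparators a₁ b₁).uIcc_subset hσ hτ
  rw [lineIntegral, lineIntegral, integral_mul_const, integral_mul_const,
    integral_vertical_eq (fun s hs => (differentiableAt_foxKernel (hsub hs)).fun_mul (by fun_prop))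
      ((expGrowthOnStrip_foxKernel isCompact_uIcc hsub).mul
        (expGrowthOnStrip_exp_mul isCompact_uIcc.isBounded k)) hintσ hintτ]

lemma foxIntegrand_eq_mul_exp (a₁ a₂ b₁ b₂ : List (ℂ × ℝ)) {z : ℂ} (hz : z ≠ 0) :
    foxIntegrand a₁ a₂ b₁ b₂ z = fun s => foxKernel a₁ a₂ b₁ b₂ s * cexp (-log z * s) := by
  ext s
  rw [foxIntegrand, cpow_def_of_ne_zero hz, mul_neg, neg_mul]

lemma meijerIntegrand_eq_mul_exp (a₁ a₂ b₁ b₂ : List ℂ) {z : ℂ} (hz : z ≠ 0) (r : ℝ) :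
    meijerIntegrand a₁ a₂ b₁ b₂ z r = fun s =>
      foxKernel (withOne a₁) (withOne a₂) (withOne b₁) (withOne b₂) s *
        cexp (-log z / r * s) := by
  ext s
  rw [meijerIntegrand, cpow_def_of_ne_zero hz, meijerKernel_eq_foxKernel, mul_div_assoc', mul_neg,
    ← neg_mul, mul_div_right_comm]

lemma IsFoxContour.mem_poleSeparators {z : ℂ} {γ : ℝ} (h : IsFoxContour a₁ a₂ b₁ b₂ z γ) :
    γ ∈ poleSeparators a₁ b₁ :=
  ⟨h.left, h.right⟩

theorem foxH_eq_lineIntegral {z : ℂ} (hz : z ≠ 0) {γ : ℝ} (h : IsFoxContour a₁ a₂ b₁ b₂ z γ) :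
    foxH a₁ a₂ b₁ b₂ z = lineIntegral (foxIntegrand a₁ a₂ b₁ b₂ z) γ := by
  have hex : ∃ γ, IsFoxContour a₁ a₂ b₁ b₂ z γ := ⟨γ, h⟩
  have hchosen := hex.choose_spec.integrable
  have hγ := h.integrable
  rw [foxIntegrand_eq_mul_exp a₁ a₂ b₁ b₂ hz] at hchosen hγ
  rw [foxH, dif_pos hex, foxIntegrand_eq_mul_exp a₁ a₂ b₁ b₂ hz]
  exact lineIntegral_foxKernel_mul_exp_eq hex.choose_spec.mem_poleSeparators h.mem_poleSeparators
    hchosen hγ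

end Kernels

section MeijerContours

open Filter Asymptotics

variable {a₁ a₂ b₁ b₂ : List ℂ} {z : ℂ} {r γ : ℝ}

lemma IsMeijerContour.mem_poleSeparators (h : IsMeijerContour a₁ a₂ b₁ b₂ z r γ) :
    γ ∈ poleSeparators (withOne a₁) (withOne b₁) :=
  mem_poleSeparators_withOne.mpr ⟨h.left, h.right⟩

theorem meijerGr_eq_lineIntegral (hz : z ≠ 0) (h : IsMeijerContour a₁ a₂ b₁ b₂ z r γ) :
    meijerGr a₁ a₂ b₁ b₂ z r = lineIntegral (meijerIntegrand a₁ a₂ b₁ b₂ z r) γ := by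
  have hex : ∃ γ, IsMeijerContour a₁ a₂ b₁ b₂ z r γ := ⟨γ, h⟩
  have hchosen := hex.choose_spec.integrable
  have hγ := h.integrable
  rw [meijerIntegrand_eq_mul_exp a₁ a₂ b₁ b₂ hz] at hchosen hγ
  rw [meijerGr, dif_pos hex, meijerIntegrand_eq_mul_exp a₁ a₂ b₁ b₂ hz]
  exact lineIntegral_foxKernel_mul_exp_eq hex.choose_spec.mem_poleSeparators h.mem_poleSeparators
    hchosen hγ

lemma integrableAtFilter_verticalModel_zero {e : ℝ} (he : e < -1) :
    IntegrableAtFilter (verticalModel e 0) (cocompact ℝ) := by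
  have h : Integrable fun y : ℝ => (1 + ‖y‖) ^ (- -e) :=
    integrable_one_add_norm (by simpa using lt_neg_of_lt_neg he)
  refine (h.congr (.of_forall fun y => ?_)).integrableAtFilter _
  simp only [verticalModel, neg_neg, zero_mul, Real.exp_zero, mul_one, Real.norm_eq_abs]

lemma verticalModel_isBigO_one {e d : ℝ} (hd : d < 0) :
    verticalModel e d =O[cocompact ℝ] fun _ => (1 : ℝ) := by
  have hT : Tendsto (fun y : ℝ => 1 + |y|) (cocompact ℝ) atTop :=
    tendsto_atTop_add_const_left _ _ (tendsto_norm_cocompact_atTop (E := ℝ))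
  have h := (((tendsto_rpow_mul_exp_neg_mul_atTop_nhds_zero e (-d) (neg_pos.mpr hd)).comp
    hT).isBigO_one ℝ).const_mul_left (Real.exp (-d))
  refine h.congr_left fun y => ?_
  rw [Function.comp_apply, verticalModel, neg_neg, mul_add, mul_one, Real.exp_add, mul_left_comm,
    ← mul_assoc (Real.exp (-d)), ← Real.exp_add, neg_add_cancel, Real.exp_zero, one_mul]

lemma verticalModel_isBigO_of_neg {e d : ℝ} (hd : d < 0) (e' : ℝ) :
    verticalModel e d =O[cocompact ℝ] verticalModel e' 0 := by
  have h := (verticalModel_isBigO_one (e := e - e') hd).mul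
    (isBigO_refl (verticalModel e' 0) (cocompact ℝ))
  simpa only [verticalModel_mul, sub_add_cancel, add_zero, one_mul] using h

lemma integrable_of_isBigO_verticalModel {E : Type*} [NormedAddCommGroup E] {f : ℝ → E}
    (hf : Continuous f) {e d : ℝ} (h : f =O[cocompact ℝ] verticalModel e d)
    (hed : d < 0 ∨ d = 0 ∧ e < -1) : Integrable f := by
  rcases hed with hd | ⟨rfl, he⟩
  · exact hf.locallyIntegrable.integrable_of_isBigO_cocompact
      (h.trans (verticalModel_isBigO_of_neg hd (-2)))
      (integrableAtFilter_verticalModel_zero (by norm_num))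
  · exact hf.locallyIntegrable.integrable_of_isBigO_cocompact h
      (integrableAtFilter_verticalModel_zero he)

lemma continuous_meijerIntegrand_vertical (hz : z ≠ 0) (r : ℝ)
    (hγ : γ ∈ poleSeparators (withOne a₁) (withOne b₁)) :
    Continuous fun y : ℝ => meijerIntegrand a₁ a₂ b₁ b₂ z r (γ + y * I) := by
  rw [meijerIntegrand_eq_mul_exp a₁ a₂ b₁ b₂ hz]
  refine continuous_iff_continuousAt.mpr fun y => ?_
  have hkernel := differentiableAt_foxKernel (a₁ := withOne a₁) (a₂ := withOne a₂)
    (b₁ := withOne b₁) (b₂ := withOne b₂) (s := γ + y * I) (by simpa using hγ)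
  exact (hkernel.continuousAt.comp (f := fun y : ℝ => (γ : ℂ) + y * I) (by fun_prop)).mul
    (by fun_prop)

lemma isBigO_cpow_vertical (hz : z ≠ 0) (r γ : ℝ) :
    (fun y : ℝ => z ^ (-(γ + y * I) / (r : ℂ))) =O[cocompact ℝ]
      verticalModel 0 (|z.arg| / |r|) := by
  refine .of_bound (‖z‖ ^ (-γ / r)) (.of_forall fun y => ?_)
  rw [norm_cpow_of_ne_zero hz, Real.norm_of_nonneg (verticalModel_pos _ _ _).le,
    verticalModel_zero_left, div_eq_mul_inv, ← Real.exp_neg]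
  have hre : (-(γ + y * I) / (r : ℂ)).re = -γ / r := by simp
  have him : (-(γ + y * I) / (r : ℂ)).im = -y / r := by simp
  rw [hre, him]
  gcongr
  calc -(z.arg * (-y / r)) ≤ |z.arg * (-y / r)| := neg_le_abs _
    _ = |z.arg| / |r| * |y| := by rw [abs_mul, abs_div, abs_neg, mul_div_left_comm, mul_comm]

lemma isBigO_meijerIntegrand_vertical (a₁ a₂ b₁ b₂ : List ℂ) (hz : z ≠ 0) (r γ : ℝ) :
    (fun y : ℝ => meijerIntegrand a₁ a₂ b₁ b₂ z r (γ + y * I)) =O[cocompact ℝ]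
      verticalModel ((((b₁ ++ b₂).length : ℝ) - (a₁ ++ a₂).length) * γ +
        (meijerMu a₁ a₂ b₁ b₂).re - 1) (|z.arg| / |r| - meijerC a₁ a₂ b₁ b₂ * Real.pi) := by
  refine ((isTheta_meijerKernel_vertical a₁ a₂ b₁ b₂ γ).isBigO.mul
    (isBigO_cpow_vertical hz r γ)).congr_right fun y => ?_
  rw [verticalModel_mul, add_zero, neg_add_eq_sub, mul_comm Real.pi]

theorem MeijerConvergence.isMeijerContour (hz : z ≠ 0) (hr : r ≠ 0)
    (hleft : ∀ b ∈ b₁, -b.re < γ) (hright : ∀ a ∈ a₁, γ < 1 - a.re)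
    (h : MeijerConvergence a₁ a₂ b₁ b₂ z r γ) : IsMeijerContour a₁ a₂ b₁ b₂ z r γ := by
  have hl : ∀ b ∈ b₁, 0 < b.re + γ := fun b hb => neg_lt_iff_pos_add'.mp (hleft b hb)
  have hr' : ∀ a ∈ a₁, 0 < 1 - a.re - γ := fun a ha => sub_pos.mpr (hright a ha)
  refine ⟨hl, hr', integrable_of_isBigO_verticalModel
    (continuous_meijerIntegrand_vertical hz r (mem_poleSeparators_withOne.mpr ⟨hl, hr'⟩))
    (isBigO_meijerIntegrand_vertical a₁ a₂ b₁ b₂ hz r γ) ?_⟩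
  rcases h with ⟨-, harg⟩ | ⟨hc, harg, hμ⟩
  · left
    rw [sub_neg, div_lt_iff₀ (abs_pos.mpr hr)]
    linarith
  · right
    rw [hc, harg, abs_zero, zero_div, zero_mul, sub_zero]
    exact ⟨rfl, by linarith⟩

end MeijerContours

section BetaTransform

/-- The factor by which integration against the Beta density
`t ^ (α - 1) * (1 - t) ^ (β - 1) / Γ(β)` multiplies the kernel `F` of a Mellin–Barnes integral of
`F s * t ^ (-κ s)`. -/
noncomputable def gammaRatio (α β : ℂ) (κ : ℝ) (s : ℂ) : ℂ :=
  Gamma (α - κ * s) / Gamma (α + β - κ * s)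

lemma lineIntegral_eq (F : ℂ → ℂ) (γ : ℝ) :
    lineIntegral F γ = 1 / (2 * (Real.pi : ℂ)) * ∫ y : ℝ, F (γ + y * I) := by
  rw [lineIntegral, integral_mul_const, mul_comm (∫ y : ℝ, F (γ + y * I)), ← mul_assoc, ← div_div,
    div_mul_cancel₀ _ I_ne_zero]

variable {α β : ℂ} {κ γ : ℝ} {F : ℂ → ℂ}

lemma setIntegral_beta_mul_eq (hβ : 0 < β.re) {s : ℂ} (hs : κ * s.re < α.re) (c : ℂ) :
    ∫ t : ℝ in Set.Ioc 0 1, (t : ℂ) ^ (α - κ * s - 1) * (1 - (t : ℂ)) ^ (β - 1) * c =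
      Gamma β * (c * gammaRatio α β κ s) := by
  have hre : 0 < (α - κ * s).re := by simpa using hs
  rw [integral_mul_const, ← intervalIntegral.integral_of_le zero_le_one]
  change betaIntegral (α - κ * s) β * c = _
  rw [betaIntegral_eq_Gamma_mul_div _ _ hre hβ, gammaRatio, sub_add_eq_add_sub]
  ring

lemma integrable_prod_beta_mul (hβ : 0 < β.re) (hα : κ * γ < α.re)
    (hF : VerticalIntegrable F γ) :
    Integrable (fun p : ℝ × ℝ => (p.1 : ℂ) ^ (α - κ * (γ + p.2 * I) - 1) *
      (1 - (p.1 : ℂ)) ^ (β - 1) * F (γ + p.2 * I))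
      ((volume.restrict (Set.Ioc 0 1)).prod volume) := by
  have hbeta : IntegrableOn (fun t : ℝ => (t : ℂ) ^ (α - κ * γ - 1) * (1 - (t : ℂ)) ^ (β - 1))
      (Set.Ioc 0 1) := by
    rw [← intervalIntegrable_iff_integrableOn_Ioc_of_le zero_le_one]
    exact betaIntegral_convergent (by simpa using hα) hβ
  refine (hbeta.mul_prod hF).mono ?_ ?_
  · exact (Measurable.aestronglyMeasurable (by fun_prop)).mul hF.aestronglyMeasurable.comp_snd
  · have hpos : ∀ᵐ p : ℝ × ℝ ∂(volume.restrict (Set.Ioc 0 1)).prod volume, p.1 ∈ Set.Ioc 0 1 :=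
      Measure.quasiMeasurePreserving_fst.ae (ae_restrict_mem measurableSet_Ioc)
    filter_upwards [hpos] with p hp
    rw [norm_mul, norm_mul, norm_mul, norm_mul, norm_cpow_eq_rpow_re_of_pos hp.1,
      norm_cpow_eq_rpow_re_of_pos hp.1]
    simp

lemma beta_mul_lineIntegral_eq {t : ℝ} (ht : 0 < t) :
    (t : ℂ) ^ (α - 1) * (1 - (t : ℂ)) ^ (β - 1) *
        lineIntegral (fun s => F s * (t : ℂ) ^ (-(κ * s))) γ =
      1 / (2 * (Real.pi : ℂ)) * ∫ y : ℝ, (t : ℂ) ^ (α - κ * (γ + y * I) - 1) *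
        (1 - (t : ℂ)) ^ (β - 1) * F (γ + y * I) := by
  rw [lineIntegral_eq, mul_left_comm, ← integral_const_mul]
  congr 2 with y
  rw [sub_right_comm, sub_eq_add_neg (α - 1), cpow_add _ _ (ofReal_ne_zero.mpr ht.ne')]
  ring

theorem intervalIntegrable_beta_mul_lineIntegral (hβ : 0 < β.re) (hα : κ * γ < α.re)
    (hF : VerticalIntegrable F γ) :
    IntervalIntegrable (fun t : ℝ => (t : ℂ) ^ (α - 1) * (1 - (t : ℂ)) ^ (β - 1) *
      lineIntegral (fun s => F s * (t : ℂ) ^ (-(κ * s))) γ) volume 0 1 := by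
  rw [intervalIntegrable_iff_integrableOn_Ioc_of_le zero_le_one,
    integrableOn_congr_fun (fun t ht => beta_mul_lineIntegral_eq ht.1) measurableSet_Ioc]
  exact (integrable_prod_beta_mul hβ hα hF).integral_prod_left.const_mul _

theorem verticalIntegrable_mul_gammaRatio (hβ : 0 < β.re) (hα : κ * γ < α.re)
    (hF : VerticalIntegrable F γ) :
    VerticalIntegrable (fun s => F s * gammaRatio α β κ s) γ := by
  refine ((integrable_prod_beta_mul hβ hα hF).integral_prod_right.const_mul
    (Gamma β)⁻¹).congr (.of_forall fun y => ?_)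
  simp only [setIntegral_beta_mul_eq hβ (s := γ + y * I) (by simpa using hα)]
  exact inv_mul_cancel_left₀ (Gamma_ne_zero_of_re_pos hβ) _

theorem integral_beta_mul_lineIntegral (hβ : 0 < β.re) (hα : κ * γ < α.re)
    (hF : VerticalIntegrable F γ) :
    ∫ t : ℝ in (0 : ℝ)..1, (t : ℂ) ^ (α - 1) * (1 - (t : ℂ)) ^ (β - 1) *
        lineIntegral (fun s => F s * (t : ℂ) ^ (-(κ * s))) γ =
      Gamma β * lineIntegral (fun s => F s * gammaRatio α β κ s) γ := by
  rw [intervalIntegral.integral_of_le zero_le_one, setIntegral_congr_fun measurableSet_Ioc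
    fun t ht => beta_mul_lineIntegral_eq ht.1, integral_const_mul,
    integral_integral_swap (integrable_prod_beta_mul hβ hα hF), lineIntegral_eq, mul_left_comm,
    ← integral_const_mul (Gamma β)]
  congr 2 with y
  exact setIntegral_beta_mul_eq hβ (by simpa using hα) _

end BetaTransform

section RiemannLiouville

variable {a₁ a₂ b₁ b₂ : List ℂ} {α β w x z : ℂ} {g r γ : ℝ}

lemma ofReal_mul_cpow {t : ℝ} (ht : 0 ≤ t) (hz : z ≠ 0) (c : ℂ) :
    ((t : ℂ) * z) ^ c = (t : ℂ) ^ c * z ^ c := by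
  rcases ht.eq_or_lt with rfl | ht
  · rcases eq_or_ne c 0 with rfl | hc
    · simp only [cpow_zero, mul_one]
    · rw [ofReal_zero, zero_mul, zero_cpow hc, zero_mul]
  · have ht' : (t : ℂ) ≠ 0 := ofReal_ne_zero.mpr ht.ne'
    rw [cpow_def_of_ne_zero (mul_ne_zero ht' hz), cpow_def_of_ne_zero ht', cpow_def_of_ne_zero hz,
      log_ofReal_mul ht hz, add_mul, exp_add, ofReal_log ht.le]

lemma mul_ofReal_mul_cpow (w : ℂ) (hz : z ≠ 0) (g : ℝ) {t : ℝ} (ht : 0 ≤ t) :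
    w * ((t : ℂ) * z) ^ (g : ℂ) = ((t ^ g : ℝ) : ℂ) * (w * z ^ (g : ℂ)) := by
  rw [ofReal_mul_cpow ht hz, ofReal_cpow ht, mul_left_comm]

lemma mul_cpow_ne_zero (hw : w ≠ 0) (hz : z ≠ 0) (c : ℂ) : w * z ^ c ≠ 0 :=
  mul_ne_zero hw (cpow_ne_zero_iff.mpr (.inl hz))

lemma meijerIntegrand_ofReal_mul (a₁ a₂ b₁ b₂ : List ℂ) (hx : x ≠ 0) (g r : ℝ) {t : ℝ}
    (ht : 0 < t) (s : ℂ) :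
    meijerIntegrand a₁ a₂ b₁ b₂ (((t ^ g : ℝ) : ℂ) * x) r s =
      meijerIntegrand a₁ a₂ b₁ b₂ x r s * (t : ℂ) ^ (-((g / r : ℝ) * s)) := by
  have htg : 0 < t ^ g := Real.rpow_pos_of_pos ht g
  have hpow : ((t ^ g : ℝ) : ℂ) ^ (-s / (r : ℂ)) = (t : ℂ) ^ (-((g / r : ℝ) * s)) := by
    rw [cpow_def_of_ne_zero (ofReal_ne_zero.mpr htg.ne'),
      cpow_def_of_ne_zero (ofReal_ne_zero.mpr ht.ne'), ← ofReal_log htg.le, ← ofReal_log ht.le,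
      Real.log_rpow ht]
    push_cast
    ring_nf
  rw [meijerIntegrand, meijerIntegrand, ofReal_mul_cpow htg.le hx, hpow, mul_left_comm, mul_comm]

lemma MeijerConvergence.ofReal_mul {ρ : ℝ} (hρ : 0 < ρ)
    (h : MeijerConvergence a₁ a₂ b₁ b₂ x r γ) : MeijerConvergence a₁ a₂ b₁ b₂ (ρ * x) r γ := by
  rwa [MeijerConvergence, arg_real_mul x hρ]

theorem MeijerConvergence.isMeijerContour_segment (hw : w ≠ 0) (hz : z ≠ 0) (hr : r ≠ 0)
    (hleft : ∀ b ∈ b₁, -b.re < γ) (hright : ∀ a ∈ a₁, γ < 1 - a.re)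
    (hconv : MeijerConvergence a₁ a₂ b₁ b₂ (w * z ^ (g : ℂ)) r γ) {t : ℝ} (ht : 0 < t) :
    IsMeijerContour a₁ a₂ b₁ b₂ (w * (t * z) ^ (g : ℂ)) r γ := by
  refine isMeijerContour (mul_cpow_ne_zero hw
    (mul_ne_zero (ofReal_ne_zero.mpr ht.ne') hz) _) hr hleft hright ?_
  rw [mul_ofReal_mul_cpow w hz g ht.le]
  exact hconv.ofReal_mul (Real.rpow_pos_of_pos ht g)

lemma rlIntegrand_cpow_mul (hz : z ≠ 0) (f : ℂ → ℂ) {t : ℝ} (ht : t ∈ Set.Icc (0 : ℝ) 1) :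
    rlIntegrand β (fun τ => τ ^ (α - 1) * f τ) z t =
      z ^ (α + β - 1) * ((t : ℂ) ^ (α - 1) * (1 - (t : ℂ)) ^ (β - 1) * f (t * z)) := by
  have hz_pow : z ^ (α + β - 1) = z ^ (β - 1) * z ^ (α - 1) * z := by
    nth_rw 4 [← cpow_one z]
    rw [← cpow_add _ _ hz, ← cpow_add _ _ hz]
    ring_nf
  have hsub : z - t * z = ((1 - t : ℝ) : ℂ) * z := by
    push_cast
    ring
  rw [rlIntegrand, hsub, ofReal_mul_cpow (sub_nonneg.mpr ht.2) hz, ofReal_mul_cpow ht.1 hz, hz_pow,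
    ofReal_sub, ofReal_one]
  ring

lemma rlIntegrand_cpow_mul_meijerGr (hw : w ≠ 0) (hz : z ≠ 0) {t : ℝ} (ht : t ∈ Set.Ioc (0 : ℝ) 1)
    (h : IsMeijerContour a₁ a₂ b₁ b₂ (w * (t * z) ^ (g : ℂ)) r γ) :
    rlIntegrand β (fun τ => τ ^ (α - 1) * meijerGr a₁ a₂ b₁ b₂ (w * τ ^ (g : ℂ)) r) z t =
      z ^ (α + β - 1) * ((t : ℂ) ^ (α - 1) * (1 - (t : ℂ)) ^ (β - 1) *
        lineIntegral (fun s => meijerIntegrand a₁ a₂ b₁ b₂ (w * z ^ (g : ℂ)) r s *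
          (t : ℂ) ^ (-((g / r : ℝ) * s))) γ) := by
  have htz : (t : ℂ) * z ≠ 0 := mul_ne_zero (ofReal_ne_zero.mpr ht.1.ne') hz
  rw [rlIntegrand_cpow_mul hz _ (Set.Ioc_subset_Icc_self ht),
    meijerGr_eq_lineIntegral (mul_cpow_ne_zero hw htz _) h, mul_ofReal_mul_cpow w hz g ht.1.le]
  rw [funext (meijerIntegrand_ofReal_mul a₁ a₂ b₁ b₂ (mul_cpow_ne_zero hw hz _) g r ht.1)]

lemma verticalIntegrable_of_segment
    (h : ∀ t ∈ Set.Ioc (0 : ℝ) 1, IsMeijerContour a₁ a₂ b₁ b₂ (w * (t * z) ^ (g : ℂ)) r γ) :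
    VerticalIntegrable (meijerIntegrand a₁ a₂ b₁ b₂ (w * z ^ (g : ℂ)) r) γ := by
  simpa using (h 1 (by simp)).integrable

theorem intervalIntegrable_rlIntegrand_meijerGr (hw : w ≠ 0) (hz : z ≠ 0) (hβ : 0 < β.re)
    (hα : g / r * γ < α.re)
    (h : ∀ t ∈ Set.Ioc (0 : ℝ) 1, IsMeijerContour a₁ a₂ b₁ b₂ (w * (t * z) ^ (g : ℂ)) r γ) :
    IntervalIntegrable
      (rlIntegrand β (fun τ => τ ^ (α - 1) * meijerGr a₁ a₂ b₁ b₂ (w * τ ^ (g : ℂ)) r) z)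
      volume 0 1 := by
  have hbeta := (intervalIntegrable_beta_mul_lineIntegral hβ hα
    (verticalIntegrable_of_segment h)).const_mul (z ^ (α + β - 1))
  refine hbeta.congr fun t ht => ?_
  rw [Set.uIoc_of_le zero_le_one] at ht
  exact (rlIntegrand_cpow_mul_meijerGr hw hz ht (h t ht)).symm

theorem rlIntegral_meijerGr (hw : w ≠ 0) (hz : z ≠ 0) (hβ : 0 < β.re) (hα : g / r * γ < α.re)
    (h : ∀ t ∈ Set.Ioc (0 : ℝ) 1, IsMeijerContour a₁ a₂ b₁ b₂ (w * (t * z) ^ (g : ℂ)) r γ) :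
    rlIntegral β (fun τ => τ ^ (α - 1) * meijerGr a₁ a₂ b₁ b₂ (w * τ ^ (g : ℂ)) r) z =
      z ^ (α + β - 1) * lineIntegral (fun s => meijerIntegrand a₁ a₂ b₁ b₂ (w * z ^ (g : ℂ)) r s *
        gammaRatio α β (g / r) s) γ := by
  have hbeta := integral_beta_mul_lineIntegral hβ hα (verticalIntegrable_of_segment h)
  rw [intervalIntegral.integral_of_le zero_le_one] at hbeta
  rw [rlIntegral, intervalIntegral.integral_of_le zero_le_one, setIntegral_congr_fun
    measurableSet_Ioc fun t ht => rlIntegrand_cpow_mul_meijerGr hw hz ht (h t ht),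
    integral_const_mul, hbeta, mul_left_comm, one_div,
    inv_mul_cancel_left₀ (Gamma_ne_zero_of_re_pos hβ)]

end RiemannLiouville

section FoxForm

variable {a₁ a₂ b₁ b₂ : List ℂ} {α β w z : ℂ} {g r γ : ℝ}

lemma foxKernel_cons_append (a₁ a₂ b₁ b₂ : List ℂ) (α β : ℂ) (κ : ℝ) (s : ℂ) :
    foxKernel ((1 - α, κ) :: withOne a₁) (withOne a₂) (withOne b₁)
        (withOne b₂ ++ [(1 - α - β, κ)]) s =
      meijerKernel a₁ a₂ b₁ b₂ s * gammaRatio α β κ s := by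
  have hnum : 1 - (1 - α) - κ * s = α - κ * s := by ring
  have hden : 1 - (1 - α - β) - κ * s = α + β - κ * s := by ring
  simp only [meijerKernel_eq_foxKernel, foxKernel, gammaRatio, List.map_cons, List.prod_cons,
    List.map_append, List.prod_append, List.map_nil, List.prod_nil, mul_one, hnum, hden,
    div_eq_mul_inv, mul_inv]
  ring

lemma log_norm_cpow_mul_cpow (hw : w ≠ 0) (hz : z ≠ 0) (g : ℝ) (hr : r ≠ 0) :
    Real.log ‖w ^ (1 / r : ℂ) * z ^ (g / r : ℂ)‖ = Real.log ‖w * z ^ (g : ℂ)‖ / r := by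
  have hw' : 0 < ‖w‖ := norm_pos_iff.mpr hw
  have hz' : 0 < ‖z‖ := norm_pos_iff.mpr hz
  rw [← ofReal_one, ← ofReal_div, ← ofReal_div, norm_mul, norm_mul, norm_cpow_real, norm_cpow_real,
    norm_cpow_real, Real.log_mul (Real.rpow_pos_of_pos hw' _).ne' (Real.rpow_pos_of_pos hz' _).ne',
    Real.log_mul hw'.ne' (Real.rpow_pos_of_pos hz' _).ne', Real.log_rpow hw', Real.log_rpow hz',
    Real.log_rpow hz']
  field_simp

lemma log_cpow_mul_cpow (hw : w ≠ 0) (hz : z ≠ 0) (hr : r ≠ 0)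
    (harg : (w * z ^ (g : ℂ)).arg = r * (w ^ (1 / r : ℂ) * z ^ (g / r : ℂ)).arg) :
    log (w ^ (1 / r : ℂ) * z ^ (g / r : ℂ)) = log (w * z ^ (g : ℂ)) / r := by
  have hr' : (r : ℂ) ≠ 0 := ofReal_ne_zero.mpr hr
  rw [log, log, log_norm_cpow_mul_cpow hw hz g hr, harg]
  push_cast
  field_simp

lemma cpow_mul_cpow_ne_zero (hw : w ≠ 0) (hz : z ≠ 0) (c d : ℂ) : w ^ c * z ^ d ≠ 0 :=
  mul_cpow_ne_zero (cpow_ne_zero_iff.mpr (.inl hw)) hz d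

lemma foxIntegrand_cons_append (a₁ a₂ b₁ b₂ : List ℂ) (α β : ℂ) (hw : w ≠ 0) (hz : z ≠ 0)
    (hr : r ≠ 0)
    (harg : (w * z ^ (g : ℂ)).arg = r * (w ^ (1 / r : ℂ) * z ^ (g / r : ℂ)).arg) :
    foxIntegrand ((1 - α, g / r) :: withOne a₁) (withOne a₂) (withOne b₁)
        (withOne b₂ ++ [(1 - α - β, g / r)]) (w ^ (1 / r : ℂ) * z ^ (g / r : ℂ)) =
      fun s => meijerIntegrand a₁ a₂ b₁ b₂ (w * z ^ (g : ℂ)) r s * gammaRatio α β (g / r) s := by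
  ext s
  have hpow : (w ^ (1 / r : ℂ) * z ^ (g / r : ℂ)) ^ (-s) = (w * z ^ (g : ℂ)) ^ (-s / (r : ℂ)) := by
    rw [cpow_def_of_ne_zero (cpow_mul_cpow_ne_zero hw hz _ _),
      cpow_def_of_ne_zero (mul_cpow_ne_zero hw hz _), log_cpow_mul_cpow hw hz hr harg,
      div_mul_eq_mul_div, mul_div_assoc]
  rw [foxIntegrand, foxKernel_cons_append, meijerIntegrand, hpow, mul_right_comm]

theorem IsMeijerContour.isFoxContour_cons_append (hw : w ≠ 0) (hz : z ≠ 0) (hr : r ≠ 0)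
    (hgr : 0 < g / r) (hβ : 0 < β.re) (hα : g / r * γ < α.re)
    (harg : (w * z ^ (g : ℂ)).arg = r * (w ^ (1 / r : ℂ) * z ^ (g / r : ℂ)).arg)
    (h : IsMeijerContour a₁ a₂ b₁ b₂ (w * z ^ (g : ℂ)) r γ) :
    IsFoxContour ((1 - α, g / r) :: withOne a₁) (withOne a₂) (withOne b₁)
      (withOne b₂ ++ [(1 - α - β, g / r)]) (w ^ (1 / r : ℂ) * z ^ (g / r : ℂ)) γ where
  pos := by
    have hone (l : List ℂ) : ∀ c ∈ withOne l, 0 < c.2 := forall_mem_withOne.mpr fun _ _ => one_pos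
    simp only [List.forall_mem_append, List.forall_mem_cons]
    exact ⟨⟨⟨⟨hgr, hone a₁⟩, hone a₂⟩, hone b₁⟩, hone b₂, hgr, List.forall_mem_nil _⟩
  left := (mem_poleSeparators_withOne.mpr ⟨h.left, h.right⟩).1
  right := by
    refine List.forall_mem_cons.mpr ⟨?_, (mem_poleSeparators_withOne.mpr ⟨h.left, h.right⟩).2⟩
    simp only [sub_re, one_re]
    linarith
  integrable := by
    rw [foxIntegrand_cons_append a₁ a₂ b₁ b₂ α β hw hz hr harg]
    exact verticalIntegrable_mul_gammaRatio hβ hα h.integrable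

theorem foxH_cons_append (hw : w ≠ 0) (hz : z ≠ 0) (hr : r ≠ 0)
    (harg : (w * z ^ (g : ℂ)).arg = r * (w ^ (1 / r : ℂ) * z ^ (g / r : ℂ)).arg)
    (h : IsFoxContour ((1 - α, g / r) :: withOne a₁) (withOne a₂) (withOne b₁)
      (withOne b₂ ++ [(1 - α - β, g / r)]) (w ^ (1 / r : ℂ) * z ^ (g / r : ℂ)) γ) :
    foxH ((1 - α, g / r) :: withOne a₁) (withOne a₂) (withOne b₁)
        (withOne b₂ ++ [(1 - α - β, g / r)]) (w ^ (1 / r : ℂ) * z ^ (g / r : ℂ)) =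
      lineIntegral (fun s => meijerIntegrand a₁ a₂ b₁ b₂ (w * z ^ (g : ℂ)) r s *
        gammaRatio α β (g / r) s) γ := by
  rw [foxH_eq_lineIntegral (cpow_mul_cpow_ne_zero hw hz _ _) h,
    foxIntegrand_cons_append a₁ a₂ b₁ b₂ α β hw hz hr harg]

end FoxForm

section GaussLists

variable {n : ℕ} {a b c : ℂ} {γ : ℝ}

lemma gaussList_eq_map_range (n : ℕ) (c : ℂ) :
    gaussList n c = (List.range n).map fun j : ℕ => (c + j) / n := by
  have h : (List.range n >>= fun j : ℕ => (pure (j : ℂ) : List ℂ)) =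
      (List.range n).map fun j : ℕ => (j : ℂ) :=
    (map_eq_bind_pure_comp _ (fun j : ℕ => (j : ℂ)) (List.range n)).symm
  rw [gaussList]
  exact (congrArg (List.map fun j : ℂ => (c + j) / n) h).trans (List.map_map ..)

lemma mem_gaussList : c ∈ gaussList n b ↔ ∃ j < n, (b + (j : ℂ)) / n = c := by
  simp only [gaussList_eq_map_range, List.mem_map, List.mem_range]

lemma length_gaussList (n : ℕ) (c : ℂ) : (gaussList n c).length = n := by
  rw [gaussList_eq_map_range, List.length_map, List.length_range]

lemma length_flatMap_gaussList (n : ℕ) (l : List ℂ) :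
    (l.flatMap (gaussList n)).length = n * l.length := by
  simp only [List.length_flatMap, length_gaussList, List.map_const', List.sum_replicate_nat,
    mul_comm]

lemma re_add_pos_of_mem_gaussList (h : 0 < b.re + γ) (hc : c ∈ gaussList n b) :
    0 < c.re + γ / n := by
  obtain ⟨j, hj, rfl⟩ := mem_gaussList.mp hc
  have hn : (0 : ℝ) < n := Nat.cast_pos.mpr (by omega)
  rw [div_natCast_re, add_re, natCast_re, ← add_div]
  exact div_pos (by linarith [(Nat.cast_nonneg j : (0 : ℝ) ≤ j)]) hn

lemma one_sub_re_sub_pos_of_mem_gaussList (h : 0 < 1 - a.re - γ)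
    (hc : c ∈ gaussList n a) : 0 < 1 - c.re - γ / n := by
  obtain ⟨j, hj, rfl⟩ := mem_gaussList.mp hc
  have hn : (0 : ℝ) < n := Nat.cast_pos.mpr (by omega)
  have hj' : (j : ℝ) + 1 ≤ n := by exact_mod_cast hj
  rw [div_natCast_re, add_re, natCast_re, sub_sub, ← add_div, sub_pos, div_lt_one hn]
  linarith

lemma prod_Gamma_gaussList_add (hn : n ≠ 0) (b s : ℂ) :
    ((gaussList n b).map fun c => Gamma (c + s)).prod =
      (2 * (Real.pi : ℂ)) ^ (((n : ℂ) - 1) / 2) * (n : ℂ) ^ (1 / 2 - (b + n * s)) *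
        Gamma (b + n * s) := by
  have hn' : (n : ℂ) ≠ 0 := Nat.cast_ne_zero.mpr hn
  rw [gaussList_eq_map_range, List.map_map, ← List.prod_toFinset _ List.nodup_range,
    List.toFinset_range, ← prod_Gamma_add_div hn]
  refine Finset.prod_congr rfl fun k _ => congrArg Gamma ?_
  field_simp
  ring

lemma prod_Gamma_gaussList_sub (hn : n ≠ 0) (a s : ℂ) :
    ((gaussList n a).map fun c => Gamma (1 - c - s)).prod =
      (2 * (Real.pi : ℂ)) ^ (((n : ℂ) - 1) / 2) * (n : ℂ) ^ (1 / 2 - (1 - a - n * s)) *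
        Gamma (1 - a - n * s) := by
  have hn' : (n : ℂ) ≠ 0 := Nat.cast_ne_zero.mpr hn
  rw [gaussList_eq_map_range, List.map_map, ← List.prod_toFinset _ List.nodup_range,
    List.toFinset_range, ← prod_Gamma_add_div hn, ← Finset.prod_range_reflect]
  refine Finset.prod_congr rfl fun k hk => congrArg Gamma ?_
  have hk' := Finset.mem_range.mp hk
  change 1 - (a + ((n - 1 - k : ℕ) : ℂ)) / n - s = _
  rw [Nat.sub_sub, Nat.cast_sub (by omega)]
  push_cast
  field_simp
  ring

lemma two_mul_pi_ne_zero : 2 * (Real.pi : ℂ) ≠ 0 :=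
  mul_ne_zero two_ne_zero (ofReal_ne_zero.mpr Real.pi_ne_zero)

lemma prod_Gamma_flatMap_gaussList_add (hn : n ≠ 0) (l : List ℂ) (s : ℂ) :
    ((l.flatMap (gaussList n)).map fun c => Gamma (c + s)).prod =
      (2 * (Real.pi : ℂ)) ^ (((n : ℂ) - 1) / 2 * l.length) *
        (n : ℂ) ^ (l.length * (1 / 2 - n * s) - l.sum) *
        (l.map fun b => Gamma (b + n * s)).prod := by
  induction l with
  | nil => simp
  | cons b l ih =>
    have hn_exp : ((l.length + 1 : ℕ) : ℂ) * (1 / 2 - n * s) - (b + l.sum) =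
        (1 / 2 - (b + n * s)) + (l.length * (1 / 2 - n * s) - l.sum) := by
      push_cast
      ring
    simp only [List.flatMap_cons, List.map_append, List.prod_append, ih,
      prod_Gamma_gaussList_add hn, List.map_cons, List.prod_cons, List.length_cons, List.sum_cons,
      hn_exp, cpow_add _ _ (Nat.cast_ne_zero.mpr hn)]
    rw [Nat.cast_add_one, mul_add_one, cpow_add _ _ two_mul_pi_ne_zero]
    ring

lemma prod_Gamma_flatMap_gaussList_sub (hn : n ≠ 0) (l : List ℂ) (s : ℂ) :
    ((l.flatMap (gaussList n)).map fun c => Gamma (1 - c - s)).prod =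
      (2 * (Real.pi : ℂ)) ^ (((n : ℂ) - 1) / 2 * l.length) *
        (n : ℂ) ^ (l.sum - l.length * (1 / 2 - n * s)) *
        (l.map fun a => Gamma (1 - a - n * s)).prod := by
  induction l with
  | nil => simp
  | cons a l ih =>
    have hn_exp : a + l.sum - ((l.length + 1 : ℕ) : ℂ) * (1 / 2 - n * s) =
        (1 / 2 - (1 - a - n * s)) + (l.sum - l.length * (1 / 2 - n * s)) := by
      push_cast
      ring
    simp only [List.flatMap_cons, List.map_append, List.prod_append, ih,
      prod_Gamma_gaussList_sub hn, List.map_cons, List.prod_cons, List.length_cons, List.sum_cons,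
      hn_exp, cpow_add _ _ (Nat.cast_ne_zero.mpr hn)]
    rw [Nat.cast_add_one, mul_add_one, cpow_add _ _ two_mul_pi_ne_zero]
    ring

end GaussLists

section LineIntegralScaling

variable {F : ℂ → ℂ} {c γ : ℝ}

lemma ofReal_mul_vertical (hc : c ≠ 0) (γ y : ℝ) :
    (c : ℂ) * ((γ / c : ℝ) + y * I) = γ + (c * y : ℝ) * I := by
  push_cast
  rw [mul_add, mul_div_cancel₀ _ (ofReal_ne_zero.mpr hc), mul_assoc]

lemma verticalIntegrable_comp_mul_left (hc : c ≠ 0) (h : VerticalIntegrable F γ) :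
    VerticalIntegrable (fun s => F (c * s)) (γ / c) := by
  simp only [VerticalIntegrable, ofReal_mul_vertical hc]
  exact h.comp_mul_left' hc

lemma lineIntegral_comp_mul_left (hc : 0 < c) (F : ℂ → ℂ) (γ : ℝ) :
    lineIntegral (fun s => c * F (c * s)) (γ / c) = lineIntegral F γ := by
  simp only [lineIntegral_eq, ofReal_mul_vertical hc.ne']
  rw [integral_const_mul, Measure.integral_comp_mul_left (fun y : ℝ => F (γ + y * I)),
    abs_of_pos (inv_pos.mpr hc), real_smul, ofReal_inv,
    mul_inv_cancel_left₀ (ofReal_ne_zero.mpr hc.ne')]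

lemma lineIntegral_const_mul (C : ℂ) (F : ℂ → ℂ) (γ : ℝ) :
    lineIntegral (fun s => C * F s) γ = C * lineIntegral F γ := by
  rw [lineIntegral_eq, lineIntegral_eq, integral_const_mul, mul_left_comm]

end LineIntegralScaling

section MeijerForm

variable {a₁ a₂ b₁ b₂ : List ℂ} {α β x : ℂ} {γ : ℝ} {G R : ℕ}

lemma meijerKernel_append (a₁ a₂ b₁ b₂ d₁ d₂ : List ℂ) (s : ℂ) :
    meijerKernel (d₁ ++ a₁) a₂ b₁ (b₂ ++ d₂) s =
      meijerKernel a₁ a₂ b₁ b₂ s * meijerKernel d₁ [] [] d₂ s := by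
  simp only [meijerKernel, List.map_append, List.prod_append, List.map_nil, List.prod_nil, one_mul,
    div_eq_mul_inv, mul_inv]
  ring

lemma meijerKernel_gaussList (hG : G ≠ 0) (α β s : ℂ) :
    meijerKernel (gaussList G (1 - α)) [] [] (gaussList G (1 - α - β)) s =
      (G : ℂ) ^ β * gammaRatio α β G s := by
  have hG' : (G : ℂ) ≠ 0 := Nat.cast_ne_zero.mpr hG
  have hpi : (2 * (Real.pi : ℂ)) ^ (((G : ℂ) - 1) / 2) ≠ 0 :=
    cpow_ne_zero_iff.mpr (.inl two_mul_pi_ne_zero)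
  have hnum : 1 - (1 - α) - G * s = α - G * s := by ring
  have hden : 1 - (1 - α - β) - G * s = α + β - G * s := by ring
  rw [meijerKernel, prod_Gamma_gaussList_sub hG, prod_Gamma_gaussList_sub hG, gammaRatio,
    List.map_nil, List.prod_nil, one_mul, one_mul, mul_assoc, mul_assoc,
    mul_div_mul_left _ _ hpi, mul_div_mul_comm, ← cpow_sub _ _ hG', hnum, hden, ofReal_natCast]
  congr 2
  ring

lemma mul_mul_div_mul_mul_regroup {M : Type*} [DivisionCommMonoid M]
    (e₁ e₂ e₃ e₄ f₁ f₂ f₃ f₄ x₁ x₂ x₃ x₄ : M) :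
    e₁ * f₁ * x₁ * (e₂ * f₂ * x₂) / (e₃ * f₃ * x₃ * (e₄ * f₄ * x₄)) =
      e₁ * e₂ / (e₃ * e₄) * (f₁ * f₂ / (f₃ * f₄)) * (x₁ * x₂ / (x₃ * x₄)) := by
  rw [mul_mul_mul_comm (e₁ * f₁), mul_mul_mul_comm e₁, mul_mul_mul_comm (e₃ * f₃),
    mul_mul_mul_comm e₃, mul_div_mul_comm, mul_div_mul_comm (e₁ * e₂)]

lemma meijerKernel_flatMap_gaussList (hR : R ≠ 0) (a₁ a₂ b₁ b₂ : List ℂ) (s : ℂ) :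
    meijerKernel (a₁.flatMap (gaussList R)) (a₂.flatMap (gaussList R))
        (b₁.flatMap (gaussList R)) (b₂.flatMap (gaussList R)) s =
      (2 * (Real.pi : ℂ)) ^ (((R : ℂ) - 1) * ((b₁.length : ℂ) + a₁.length -
          (((a₁ ++ a₂).length : ℂ) + (b₁ ++ b₂).length) / 2)) *
        (R : ℂ) ^ (1 - meijerMu a₁ a₂ b₁ b₂ -
          (((b₁ ++ b₂).length : ℂ) - (a₁ ++ a₂).length) * (R * s)) *
        meijerKernel a₁ a₂ b₁ b₂ (R * s) := by
  have hR' : (R : ℂ) ≠ 0 := Nat.cast_ne_zero.mpr hR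
  rw [meijerKernel, prod_Gamma_flatMap_gaussList_add hR, prod_Gamma_flatMap_gaussList_add hR,
    prod_Gamma_flatMap_gaussList_sub hR, prod_Gamma_flatMap_gaussList_sub hR,
    mul_mul_div_mul_mul_regroup, ← cpow_add _ _ two_mul_pi_ne_zero,
    ← cpow_add _ _ two_mul_pi_ne_zero, ← cpow_sub _ _ two_mul_pi_ne_zero,
    ← cpow_add _ _ hR', ← cpow_add _ _ hR', ← cpow_sub _ _ hR', meijerKernel]
  simp only [meijerMu, List.length_append, List.sum_append, Nat.cast_add]
  congr 3 <;> ring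

/-- The constant `r ^ μ / ((2π) ^ ((r - 1) c) * g ^ β)` by which passing to Gauss's parameter lists
divides a Meijer G-function. -/
noncomputable def gaussFactor (a₁ a₂ b₁ b₂ : List ℂ) (β : ℂ) (G R : ℕ) : ℂ :=
  (R : ℂ) ^ meijerMu a₁ a₂ b₁ b₂ /
    ((2 * (Real.pi : ℂ)) ^ (((R : ℂ) - 1) * ((b₁.length : ℂ) + a₁.length -
        (((a₁ ++ a₂).length : ℂ) + (b₁ ++ b₂).length) / 2)) *
      (G : ℂ) ^ β)

lemma gaussFactor_ne_zero (hG : G ≠ 0) (hR : R ≠ 0) (a₁ a₂ b₁ b₂ : List ℂ) (β : ℂ) :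
    gaussFactor a₁ a₂ b₁ b₂ β G R ≠ 0 :=
  div_ne_zero (cpow_ne_zero_iff.mpr (.inl (Nat.cast_ne_zero.mpr hR))) (mul_ne_zero
    (cpow_ne_zero_iff.mpr (.inl two_mul_pi_ne_zero))
    (cpow_ne_zero_iff.mpr (.inl (Nat.cast_ne_zero.mpr hG))))

lemma gaussFactor_mul_meijerKernel (hG : G ≠ 0) (hR : R ≠ 0) (a₁ a₂ b₁ b₂ : List ℂ) (α β s : ℂ) :
    gaussFactor a₁ a₂ b₁ b₂ β G R *
        meijerKernel (gaussList G (1 - α) ++ a₁.flatMap (gaussList R)) (a₂.flatMap (gaussList R))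
          (b₁.flatMap (gaussList R)) (b₂.flatMap (gaussList R) ++ gaussList G (1 - α - β)) s =
      R * (R : ℂ) ^ (-((((b₁ ++ b₂).length : ℂ) - (a₁ ++ a₂).length) * (R * s))) *
        (meijerKernel a₁ a₂ b₁ b₂ (R * s) * gammaRatio α β G s) := by
  have hR' : (R : ℂ) ≠ 0 := Nat.cast_ne_zero.mpr hR
  have hGβ : (G : ℂ) ^ β ≠ 0 := cpow_ne_zero_iff.mpr (.inl (Nat.cast_ne_zero.mpr hG))
  have hRμ : (R : ℂ) ^ meijerMu a₁ a₂ b₁ b₂ ≠ 0 := cpow_ne_zero_iff.mpr (.inl hR')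
  rw [meijerKernel_append, meijerKernel_gaussList hG, meijerKernel_flatMap_gaussList hR,
    gaussFactor, sub_eq_add_neg (1 - meijerMu a₁ a₂ b₁ b₂), cpow_add _ _ hR', cpow_sub _ _ hR',
    cpow_one]
  field_simp

lemma div_natCast_zpow_cpow (hx : x ≠ 0) (hR : R ≠ 0) (k : ℤ) (s : ℂ) :
    (x / (R : ℂ) ^ k) ^ s = x ^ s * (R : ℂ) ^ (-(k * s)) := by
  have hρ : (0 : ℝ) < (R : ℝ) ^ (-k) := zpow_pos (Nat.cast_pos.mpr (Nat.pos_of_ne_zero hR)) _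
  have hscale : x / (R : ℂ) ^ k = (((R : ℝ) ^ (-k) : ℝ) : ℂ) * x := by
    push_cast
    rw [zpow_neg, div_eq_inv_mul]
  rw [hscale, ofReal_mul_cpow hρ.le hx, cpow_def_of_ne_zero (ofReal_ne_zero.mpr hρ.ne'),
    cpow_def_of_ne_zero (Nat.cast_ne_zero.mpr hR), ← ofReal_log hρ.le, Real.log_zpow, ← natCast_log]
  push_cast
  ring_nf

lemma gaussFactor_mul_meijerIntegrand (hG : G ≠ 0) (hR : R ≠ 0) (a₁ a₂ b₁ b₂ : List ℂ) (α β : ℂ)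
    (hx : x ≠ 0) (s : ℂ) :
    gaussFactor a₁ a₂ b₁ b₂ β G R *
        meijerIntegrand (gaussList G (1 - α) ++ a₁.flatMap (gaussList R))
          (a₂.flatMap (gaussList R)) (b₁.flatMap (gaussList R))
          (b₂.flatMap (gaussList R) ++ gaussList G (1 - α - β))
          (x / (R : ℂ) ^ ((R : ℤ) * (((b₁ ++ b₂).length : ℤ) - (a₁ ++ a₂).length))) 1 s =
      (R : ℝ) * (meijerIntegrand a₁ a₂ b₁ b₂ x R ((R : ℝ) * s) *
        gammaRatio α β (G / R) ((R : ℝ) * s)) := by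
  have hR' : (R : ℂ) ≠ 0 := Nat.cast_ne_zero.mpr hR
  have hratio : gammaRatio α β (G / R) (R * s) = gammaRatio α β G s := by
    simp only [gammaRatio, ofReal_div, ofReal_natCast, ← mul_assoc, div_mul_cancel₀ _ hR']
  have hcancel : (R : ℂ) ^ (-((((b₁ ++ b₂).length : ℂ) - (a₁ ++ a₂).length) * (R * s))) *
      (R : ℂ) ^ (-((((R : ℤ) * (((b₁ ++ b₂).length : ℤ) - (a₁ ++ a₂).length) : ℤ) : ℂ) * -s)) =
      1 := by
    rw [← cpow_add _ _ hR', ← cpow_zero (R : ℂ)]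
    congr 1
    push_cast
    ring
  rw [meijerIntegrand, ← mul_assoc, gaussFactor_mul_meijerKernel hG hR, ofReal_one, div_one,
    div_natCast_zpow_cpow hx hR,
    ofReal_natCast, hratio, meijerIntegrand, ofReal_natCast, neg_div, mul_div_cancel_left₀ _ hR']
  linear_combination (R * x ^ (-s) * (meijerKernel a₁ a₂ b₁ b₂ (R * s) * gammaRatio α β G s)) *
    hcancel

theorem IsMeijerContour.append_gaussList (hG : G ≠ 0) (hR : R ≠ 0) (hx : x ≠ 0) (hβ : 0 < β.re)
    (hα : (G : ℝ) / R * γ < α.re) (h : IsMeijerContour a₁ a₂ b₁ b₂ x R γ) :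
    IsMeijerContour (gaussList G (1 - α) ++ a₁.flatMap (gaussList R)) (a₂.flatMap (gaussList R))
      (b₁.flatMap (gaussList R)) (b₂.flatMap (gaussList R) ++ gaussList G (1 - α - β))
      (x / (R : ℂ) ^ ((R : ℤ) * (((b₁ ++ b₂).length : ℤ) - (a₁ ++ a₂).length))) 1 (γ / R) where
  left c hc := by
    obtain ⟨b, hb, hc⟩ := List.mem_flatMap.mp hc
    exact re_add_pos_of_mem_gaussList (h.left b hb) hc
  right c hc := by
    rcases List.mem_append.mp hc with hc | hc
    · have hα' : 0 < 1 - (1 - α).re - (G : ℝ) / R * γ := by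
        rw [sub_re, one_re]
        linarith
      have hG' : (G : ℝ) ≠ 0 := Nat.cast_ne_zero.mpr hG
      convert one_sub_re_sub_pos_of_mem_gaussList hα' hc using 2
      field_simp
    · obtain ⟨a, ha, hc⟩ := List.mem_flatMap.mp hc
      exact one_sub_re_sub_pos_of_mem_gaussList (h.right a ha) hc
  integrable := by
    have hR' : (R : ℝ) ≠ 0 := Nat.cast_ne_zero.mpr hR
    have hscaled := (verticalIntegrable_comp_mul_left hR'
      (verticalIntegrable_mul_gammaRatio hβ hα h.integrable)).const_mul (R : ℝ)
    have hunit := (gaussFactor_ne_zero hG hR a₁ a₂ b₁ b₂ β).isUnit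
    refine (integrable_const_mul_iff hunit _).mp (hscaled.congr (.of_forall fun y => ?_))
    exact (gaussFactor_mul_meijerIntegrand hG hR a₁ a₂ b₁ b₂ α β hx _).symm

theorem gaussFactor_mul_meijerG (hG : G ≠ 0) (hR : R ≠ 0) (hx : x ≠ 0)
    (h : IsMeijerContour (gaussList G (1 - α) ++ a₁.flatMap (gaussList R))
      (a₂.flatMap (gaussList R)) (b₁.flatMap (gaussList R))
      (b₂.flatMap (gaussList R) ++ gaussList G (1 - α - β))
      (x / (R : ℂ) ^ ((R : ℤ) * (((b₁ ++ b₂).length : ℤ) - (a₁ ++ a₂).length))) 1 (γ / R)) :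
    gaussFactor a₁ a₂ b₁ b₂ β G R *
        meijerG (gaussList G (1 - α) ++ a₁.flatMap (gaussList R)) (a₂.flatMap (gaussList R))
          (b₁.flatMap (gaussList R)) (b₂.flatMap (gaussList R) ++ gaussList G (1 - α - β))
          (x / (R : ℂ) ^ ((R : ℤ) * (((b₁ ++ b₂).length : ℤ) - (a₁ ++ a₂).length))) =
      lineIntegral (fun s => meijerIntegrand a₁ a₂ b₁ b₂ x R s * gammaRatio α β (G / R) s) γ := by
  have hRpos : (0 : ℝ) < R := Nat.cast_pos.mpr (Nat.pos_of_ne_zero hR)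
  rw [meijerG, meijerGr_eq_lineIntegral
    (div_ne_zero hx (zpow_ne_zero _ (Nat.cast_ne_zero.mpr hR))) h, ← lineIntegral_const_mul,
    funext (gaussFactor_mul_meijerIntegrand hG hR a₁ a₂ b₁ b₂ α β hx)]
  exact lineIntegral_comp_mul_left hRpos
    (fun s => meijerIntegrand a₁ a₂ b₁ b₂ x R s * gammaRatio α β (G / R) s) γ

end MeijerForm

theorem mainTheorem2
    (a₁ a₂ b₁ b₂ : List ℂ) (α β w z : ℂ) (g r γ : ℝ)
    (hw : w ≠ 0) (hz : z ≠ 0) (hβ : 0 < β.re) (hr : r ≠ 0) (hgr : 0 < g / r)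
    (hleft : ∀ b ∈ b₁, -b.re < γ) (hright : ∀ a ∈ a₁, γ < 1 - a.re)
    (hα : g / r * γ < α.re)
    (hconv : MeijerConvergence a₁ a₂ b₁ b₂ (w * z ^ (g : ℂ)) r γ) :
    -- the G-function is defined along the segment, and the Riemann–Liouville integral converges
    (∀ t ∈ Set.Ioc (0 : ℝ) 1,
      ∃ γ' : ℝ, IsMeijerContour a₁ a₂ b₁ b₂ (w * (t * z) ^ (g : ℂ)) r γ') ∧
    IntervalIntegrable
      (rlIntegrand β (fun τ => τ ^ (α - 1) * meijerGr a₁ a₂ b₁ b₂ (w * τ ^ (g : ℂ)) r) z)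
      MeasureTheory.volume 0 1 ∧
    -- the Fox H form
    ((w * z ^ (g : ℂ)).arg = r * (w ^ (1 / r : ℂ) * z ^ (g / r : ℂ)).arg →
      (∃ γ' : ℝ, IsFoxContour ((1 - α, g / r) :: withOne a₁) (withOne a₂)
        (withOne b₁) (withOne b₂ ++ [(1 - α - β, g / r)])
        (w ^ (1 / r : ℂ) * z ^ (g / r : ℂ)) γ') ∧
      rlIntegral β (fun τ => τ ^ (α - 1) * meijerGr a₁ a₂ b₁ b₂ (w * τ ^ (g : ℂ)) r) z =
        z ^ (α + β - 1) *
          foxH ((1 - α, g / r) :: withOne a₁) (withOne a₂)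
            (withOne b₁) (withOne b₂ ++ [(1 - α - β, g / r)])
            (w ^ (1 / r : ℂ) * z ^ (g / r : ℂ))) ∧
    -- the Meijer G form for positive integers `g = G` and `r = R`
    (∀ G R : ℕ, g = G → r = R →
      ∀ p q : ℕ, p = (a₁ ++ a₂).length → q = (b₁ ++ b₂).length →
      ∀ Δ₁ Δ₂ Δ₃ Δ₄ : List ℂ,
      Δ₁ = gaussList G (1 - α) ++ a₁.flatMap (gaussList R) →
      Δ₂ = a₂.flatMap (gaussList R) →
      Δ₃ = b₁.flatMap (gaussList R) →
      Δ₄ = b₂.flatMap (gaussList R) ++ gaussList G (1 - α - β) →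
      (Δ₃.length = R * b₁.length ∧ Δ₁.length = R * a₁.length + G ∧
        (Δ₁ ++ Δ₂).length = R * p + G ∧ (Δ₃ ++ Δ₄).length = R * q + G) ∧
      (∃ γ' : ℝ, IsMeijerContour Δ₁ Δ₂ Δ₃ Δ₄
        (w * z ^ G / (R : ℂ) ^ ((R : ℤ) * ((q : ℤ) - (p : ℤ)))) 1 γ') ∧
      rlIntegral β (fun τ => τ ^ (α - 1) * meijerGr a₁ a₂ b₁ b₂ (w * τ ^ G) R) z =
        z ^ (α + β - 1) *
          ((R : ℂ) ^ ((b₁ ++ b₂).sum - (a₁ ++ a₂).sum + ((p : ℂ) - q) / 2 + 1) /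
            ((2 * (Real.pi : ℂ)) ^
                (((R : ℂ) - 1) * ((b₁.length : ℂ) + a₁.length - ((p : ℂ) + q) / 2)) *
              (G : ℂ) ^ β)) *
          meijerG Δ₁ Δ₂ Δ₃ Δ₄ (w * z ^ G / (R : ℂ) ^ ((R : ℤ) * ((q : ℤ) - (p : ℤ))))) := by
  have hx : w * z ^ (g : ℂ) ≠ 0 := mul_cpow_ne_zero hw hz _
  have hcontour := hconv.isMeijerContour hx hr hleft hright
  have hsegment : ∀ t ∈ Set.Ioc (0 : ℝ) 1,
      IsMeijerContour a₁ a₂ b₁ b₂ (w * (t * z) ^ (g : ℂ)) r γ := fun t ht =>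
    hconv.isMeijerContour_segment hw hz hr hleft hright ht.1
  have hRL := rlIntegral_meijerGr hw hz hβ hα hsegment
  refine ⟨fun t ht => ⟨γ, hsegment t ht⟩,
    intervalIntegrable_rlIntegrand_meijerGr hw hz hβ hα hsegment, fun harg => ?_, ?_⟩
  · have hfox := hcontour.isFoxContour_cons_append hw hz hr hgr hβ hα harg
    exact ⟨⟨γ, hfox⟩, by rw [hRL, foxH_cons_append hw hz hr harg hfox]⟩
  · rintro G R rfl rfl p q rfl rfl Δ₁ Δ₂ Δ₃ Δ₄ rfl rfl rfl rfl
    have hR : R ≠ 0 := Nat.cast_ne_zero.mp hr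
    have hG : G ≠ 0 := by
      rintro rfl
      simp at hgr
    simp only [ofReal_natCast, cpow_natCast] at hx hcontour hRL
    have hgauss := hcontour.append_gaussList hG hR hx hβ hα
    refine ⟨?_, ⟨γ / R, hgauss⟩, ?_⟩
    · simp only [List.length_append, length_flatMap_gaussList, length_gaussList, true_and]
      refine ⟨?_, ?_, ?_⟩ <;> ring
    · rw [hRL, ← gaussFactor_mul_meijerG hG hR hx hgauss, mul_assoc]
      rfl
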